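/- Let $K=\mathbb{F}_{p^m}$ be a finite field (any characteristic) and let $\mathcal{E}/K$ be an elliptic curve given by a Weierstrass equation $Y^2+a_1XY+a_3Y=X^3+a_2X^2+a_4X+a_6$, with point at infinity $P_\infty$ and function field $K(\mathcal{E})$. Let $\sigma\in\operatorname{Aut}(\mathcal{E}/K,P_\infty)$ be a $K$-automorphism fixing $P_\infty$, of order $\ell=\operatorname{ord}(\sigma)\in\{2,4,6\}$. Let $s\in\mathbb{N}$, let $Q_1,\dots,Q_s\in\mathcal{E}(K)$ be rational points not in $\mathcal{E}[2]\cup\mathcal{E}[3]$ (in particular $Q_z\neq P_\infty$), let $t_1,\dots,t_s\in\mathbb{Z}$, and let $c\in\mathbb{Z}$ with $c\le \ell\sum_{z=1}^s t_z$. Put $\operatorname{Orb}_\sigma(Q_z)=\{\sigma^i(Q_z): 0\le i<\ell\}$, $\mathcal{Q}_{z,\rho}=\sigma^{\rho-1}(Q_z)$ for $1\le\rho\le \ell/2$, and $$G=\sum_{z=1}^{s}t_z\sum_{Q\in\operatorname{Orb}_\sigma(Q_z)}Q\;-\;cP_\infty .$$ Then $\deg G=\ell\sum_{z=1}^s t_z-c$,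 and the functions $$\frac{X^iY^j}{\prod_{z=1}^{s}\left[\prod_{\rho=1}^{\ell/2}\bigl(X-x(\mathcal{Q}_{z,\rho})\bigr)\right]^{t_z}},\qquad i\ge 0,\quad j\in\{0,1\},\quad 2i+3j\le \ell\sum_{z=1}^{s}t_z-c,$$ where $x(\cdot)$ denotes the $x$-coordinate of a point, form a $K$-basis of the Riemann--Roch space $\mathscr{L}(G)=\{f\in K(\mathcal{E})^\times : (f)\ge -G\}\cup\{0\}$. -/

import Mathlib

open scoped WithZero

namespace AlgFunField

/-! ### Places, divisors and Riemann-Roch spaces of a function field `F / K` -/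

/-- A place of the function field `F / K`, given by its normalized discrete valuation: a surjective
valuation `F → ℤᵐ⁰` that is trivial on the field of constants `K`.  The local ring of the place is
`{f | val f ≤ 1}`, and its maximal ideal is `{f | val f < 1}`. -/
@[ext]
structure Place (K F : Type*) [Field K] [Field F] [Algebra K F] where
  val : Valuation F ℤᵐ⁰
  val_algebraMap : ∀ a : K, a ≠ 0 → val (algebraMap K F a) = 1
  surjective_val : Function.Surjective val

namespace Place

variable {K F : Type*} [Field K] [Field F] [Algebra K F]

/-- The order `v_P(f) ∈ ℤ` of a nonzero function `f` at the place `P`: positive at zeros, negative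
at poles.  (It is only used for `f ≠ 0`.) -/
noncomputable def ord (P : Place K F) (f : F) : ℤ := -WithZero.log (P.val f)

lemma val_algebraMap_le_one (P : Place K F) (a : K) : P.val (algebraMap K F a) ≤ 1 := by
  by_cases h : a = 0
  · simp [h]
  · exact (P.val_algebraMap a h).le

/-- The local ring of a place, as a vector space over `K`. -/
def localRing (P : Place K F) : Submodule K F where
  carrier := {f | P.val f ≤ 1}
  zero_mem' := by simp
  add_mem' {f g} hf hg := (P.val.map_add f g).trans (max_le hf hg)
  smul_mem' a f hf := by
    change P.val (a • f) ≤ 1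
    rw [Algebra.smul_def, map_mul]
    exact mul_le_one' (P.val_algebraMap_le_one a) hf

/-- The maximal ideal of a place, as a vector space over `K`. -/
def maximalIdeal (P : Place K F) : Submodule K F where
  carrier := {f | P.val f < 1}
  zero_mem' := by simp
  add_mem' {f g} hf hg := (P.val.map_add f g).trans_lt (max_lt hf hg)
  smul_mem' a f hf := by
    change P.val (a • f) < 1
    rw [Algebra.smul_def, map_mul]
    exact (mul_le_of_le_one_left' (P.val_algebraMap_le_one a)).trans_lt hf

/-- The degree of a place: the dimension over `K` of its residue field. -/
noncomputable def degree (P : Place K F) : ℕ :=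
  Module.finrank K (P.localRing ⧸ P.maximalIdeal.comap P.localRing.subtype)

/-- The automorphisms of `F / K` act on places by `σ P = {σ f | f ∈ P}` (for places given by their
maximal ideals), that is, `v_{σ P}(f) = v_P(σ⁻¹ f)`. -/
instance : MulAction (F ≃ₐ[K] F) (Place K F) where
  smul σ P :=
    { val := P.val.comap (σ.symm : F →+* F)
      val_algebraMap := fun a ha => by
        simpa [Valuation.comap_apply] using P.val_algebraMap a ha
      surjective_val := fun x => by
        obtain ⟨f, hf⟩ := P.surjective_val x
        exact ⟨σ f, by simpa [Valuation.comap_apply] using hf⟩ }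
  one_smul P := by ext f; rfl
  mul_smul σ τ P := by ext f; rfl

lemma smul_val (σ : F ≃ₐ[K] F) (P : Place K F) (f : F) : (σ • P).val f = P.val (σ.symm f) := rfl

open Classical in
/-- The value `f(P) ∈ K` of a function `f` at a place `P`: the element of `K` that is congruent to
`f` modulo the maximal ideal of `P`.  It exists whenever `P` has degree one and `f` has no pole at
`P`; otherwise `0` may be returned. -/
noncomputable def eval (P : Place K F) (f : F) : K :=
  if h : ∃ a : K, P.val (f - algebraMap K F a) < 1 then h.choose else 0

lemma eval_eq_of_lt {P : Place K F} {f : F} {a : K} (h : P.val (f - algebraMap K F a) < 1) :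
    P.eval f = a := by
  have h' : ∃ a : K, P.val (f - algebraMap K F a) < 1 := ⟨a, h⟩
  have h1 := h'.choose_spec
  rw [eval, dif_pos h']
  by_contra hne
  have h2 := P.val_algebraMap _ (sub_ne_zero.mpr hne)
  have h3 : P.val ((f - algebraMap K F a) - (f - algebraMap K F h'.choose)) < 1 :=
    (P.val.map_sub _ _).trans_lt (max_lt h h1)
  rw [sub_sub_sub_cancel_left, ← map_sub, h2] at h3
  exact lt_irrefl _ h3

open Classical in
/-- The orbit `{σ^i(P) | 0 ≤ i < ord σ}` of a place. -/
noncomputable def orbit (σ : F ≃ₐ[K] F) (P : Place K F) : Finset (Place K F) :=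
  (Finset.range (orderOf σ)).image fun i => σ ^ i • P

end Place

/-- Divisors: finite formal sums of places with integer coefficients. -/
abbrev Divisor (K F : Type*) [Field K] [Field F] [Algebra K F] := Place K F →₀ ℤ

variable {K F : Type*} [Field K] [Field F] [Algebra K F]

/-- The degree `∑ v_P(G) deg P` of a divisor. -/
noncomputable def Divisor.degree (G : Divisor K F) : ℤ := G.sum fun P n => n * (P.degree : ℤ)

lemma neg_le_ord_iff {P : Place K F} {f : F} (hf : f ≠ 0) (n : ℤ) :
    -n ≤ P.ord f ↔ P.val f ≤ WithZero.exp n := by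
  rw [Place.ord, neg_le_neg_iff, WithZero.log_le_iff_le_exp ((P.val.ne_zero_iff).mpr hf)]

/-- The Riemann-Roch space `L(G) = {f ≠ 0 | (f) ≥ -G} ∪ {0}`. -/
noncomputable def riemannRochSpace (G : Divisor K F) : Submodule K F where
  carrier := {f | f = 0 ∨ ∀ P : Place K F, -(G P) ≤ P.ord f}
  zero_mem' := Or.inl rfl
  add_mem' {f g} hf hg := by
    by_cases hf0 : f = 0
    · simpa [hf0] using hg
    by_cases hg0 : g = 0
    · simpa [hg0] using hf
    by_cases hfg : f + g = 0
    · exact Or.inl hfg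
    refine Or.inr fun P => (neg_le_ord_iff hfg _).mpr ?_
    exact (P.val.map_add f g).trans (max_le
      ((neg_le_ord_iff hf0 _).mp (hf.resolve_left hf0 P))
      ((neg_le_ord_iff hg0 _).mp (hg.resolve_left hg0 P)))
  smul_mem' a f hf := by
    by_cases hf0 : f = 0
    · exact Or.inl (by simp [hf0])
    by_cases ha : a = 0
    · exact Or.inl (by simp [ha])
    refine Or.inr fun P => (neg_le_ord_iff (smul_ne_zero ha hf0) _).mpr ?_
    rw [Algebra.smul_def, map_mul, P.val_algebraMap a ha, one_mul]
    exact (neg_le_ord_iff hf0 _).mp (hf.resolve_left hf0 P)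

lemma nonZeroDivisors_le_primeCompl_supp {R : Type*} [CommRing R] [IsDomain R]
    (v : Valuation R ℤᵐ⁰) (hv : ∀ r : R, r ≠ 0 → v r ≠ 0) :
    nonZeroDivisors R ≤ v.supp.primeCompl :=
  fun r hr => hv r (nonZeroDivisors.ne_zero hr)

/-- A valuation on a `K`-subalgebra `R` with fraction field `F` that is trivial on `K`, nonzero on
nonzero elements, and has two values with quotient `exp 1`, extends to a place of `F / K`. -/
noncomputable def Place.ofValuation {R : Type*} [CommRing R] [IsDomain R] [Algebra K R]
    [Algebra R F] [IsScalarTower K R F] [IsFractionRing R F] (v : Valuation R ℤᵐ⁰)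
    (hv : ∀ r : R, r ≠ 0 → v r ≠ 0) (hK : ∀ a : K, a ≠ 0 → v (algebraMap K R a) = 1)
    (h1 : ∃ a b : R, b ≠ 0 ∧ v a = WithZero.exp 1 * v b) : Place K F where
  val := v.extendToLocalization (S := nonZeroDivisors R) (nonZeroDivisors_le_primeCompl_supp v hv) F
  val_algebraMap a ha := by
    rw [IsScalarTower.algebraMap_apply K R F, Valuation.extendToLocalization_apply_map_apply,
      hK a ha]
  surjective_val := by
    obtain ⟨a, b, hb, hab⟩ := h1
    intro x
    induction x using WithZero.expRecOn with
    | zero => exact ⟨0, map_zero _⟩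
    | exp n =>
      refine ⟨(algebraMap R F a / algebraMap R F b) ^ n, ?_⟩
      rw [map_zpow₀, map_div₀, Valuation.extendToLocalization_apply_map_apply,
        Valuation.extendToLocalization_apply_map_apply, hab, mul_div_assoc, div_self (hv b hb),
        mul_one, ← WithZero.exp_zsmul, smul_eq_mul, mul_one]

end AlgFunField

/-! ### The places of the rational points of an elliptic curve -/

namespace EllipticPlaces

open Polynomial WeierstrassCurve.Affine AlgFunField

variable {K : Type*} [Field K] (W : WeierstrassCurve.Affine K)

/-- The coordinate function `X` in the function field of the curve. -/
noncomputable def funX : W.FunctionField :=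
  algebraMap W.CoordinateRing W.FunctionField (CoordinateRing.mk W (C X))

/-- The coordinate function `Y` in the function field of the curve. -/
noncomputable def funY : W.FunctionField :=
  algebraMap W.CoordinateRing W.FunctionField (CoordinateRing.mk W X)

lemma degree_norm_add_le (a b : W.CoordinateRing) :
    (Algebra.norm K[X] (a + b)).degree ≤
      max (Algebra.norm K[X] a).degree (Algebra.norm K[X] b).degree := by
  obtain ⟨p, q, rfl⟩ := CoordinateRing.exists_smul_basis_eq a
  obtain ⟨p', q', rfl⟩ := CoordinateRing.exists_smul_basis_eq b
  have h : (p • (1 : W.CoordinateRing) + q • CoordinateRing.mk W X) +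
      (p' • (1 : W.CoordinateRing) + q' • CoordinateRing.mk W X) =
      (p + p') • (1 : W.CoordinateRing) + (q + q') • CoordinateRing.mk W X := by
    simp only [add_smul]; ring
  rw [h, CoordinateRing.degree_norm_smul_basis, CoordinateRing.degree_norm_smul_basis,
    CoordinateRing.degree_norm_smul_basis]
  have e1 : 2 • (p + p').degree ≤ max (2 • p.degree) (2 • p'.degree) := by
    rcases le_total p.degree p'.degree with h1 | h1
    · exact le_max_of_le_right (nsmul_le_nsmul_right
        ((degree_add_le p p').trans (max_le h1 le_rfl)) 2)
    · exact le_max_of_le_left (nsmul_le_nsmul_right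
        ((degree_add_le p p').trans (max_le le_rfl h1)) 2)
  have e2 : 2 • (q + q').degree + 3 ≤ max (2 • q.degree + 3) (2 • q'.degree + 3) := by
    rcases le_total q.degree q'.degree with h1 | h1
    · exact le_max_of_le_right (add_le_add_left (nsmul_le_nsmul_right
        ((degree_add_le q q').trans (max_le h1 le_rfl)) 2) 3)
    · exact le_max_of_le_left (add_le_add_left (nsmul_le_nsmul_right
        ((degree_add_le q q').trans (max_le le_rfl h1)) 2) 3)
  refine max_le (e1.trans (max_le_max ?_ ?_)) (e2.trans (max_le_max ?_ ?_))
  exacts [le_max_left _ _, le_max_left _ _, le_max_right _ _, le_max_right _ _]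

lemma norm_ne_zero {a : W.CoordinateRing} (ha : a ≠ 0) : Algebra.norm K[X] a ≠ 0 := by
  obtain ⟨p, q, rfl⟩ := CoordinateRing.exists_smul_basis_eq a
  intro h0
  have h := CoordinateRing.degree_norm_smul_basis (W' := W) p q
  rw [h0, degree_zero, eq_comm, ← le_bot_iff, max_le_iff, le_bot_iff, le_bot_iff] at h
  have hp : p = 0 := by
    by_contra hp
    rw [degree_eq_natDegree hp] at h
    exact absurd h.1 (by rw [← Nat.cast_smul_eq_nsmul ℕ]; exact WithBot.coe_ne_bot)
  have hq : q = 0 := by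
    by_contra hq
    rw [degree_eq_natDegree hq] at h
    exact absurd h.2 WithBot.coe_ne_bot
  exact ha (by simp [hp, hq])

open Classical in
/-- The pole order at the point at infinity on the coordinate ring: the degree of the norm to
`K[X]`. In particular it is `2` for `X` and `3` for `Y`. -/
noncomputable def inftyValuation : Valuation W.CoordinateRing ℤᵐ⁰ where
  toFun a := if a = 0 then 0 else WithZero.exp ((Algebra.norm K[X] a).natDegree : ℤ)
  map_zero' := by simp
  map_one' := by simp
  map_mul' a b := by
    by_cases ha : a = 0
    · simp [ha]
    by_cases hb : b = 0
    · simp [hb]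
    rw [if_neg ha, if_neg hb, if_neg (mul_ne_zero ha hb), map_mul,
      natDegree_mul (norm_ne_zero W ha) (norm_ne_zero W hb), Nat.cast_add, WithZero.exp_add]
  map_add_le_max' a b := by
    by_cases ha : a = 0
    · simp [ha]
    by_cases hb : b = 0
    · simp [hb]
    by_cases hab : a + b = 0
    · simp [hab]
    rw [if_neg ha, if_neg hb, if_neg hab, le_max_iff, WithZero.exp_le_exp, WithZero.exp_le_exp,
      Nat.cast_le, Nat.cast_le]
    exact (le_max_iff.mp (degree_norm_add_le W a b)).imp natDegree_le_natDegree
      natDegree_le_natDegree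

lemma inftyValuation_apply {a : W.CoordinateRing} (ha : a ≠ 0) :
    inftyValuation W a = WithZero.exp ((Algebra.norm K[X] a).natDegree : ℤ) := by
  simp [inftyValuation, ha]

lemma inftyValuation_smul_basis {p q : K[X]} {n : ℕ}
    (h : max (2 • p.degree) (2 • q.degree + 3) = n) :
    inftyValuation W (p • (1 : W.CoordinateRing) + q • CoordinateRing.mk W X) =
      WithZero.exp (n : ℤ) := by
  have h' := (CoordinateRing.degree_norm_smul_basis (W' := W) p q).trans h
  rw [inftyValuation_apply, natDegree_eq_of_degree_eq_some h']
  intro h0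
  obtain ⟨rfl, rfl⟩ := CoordinateRing.smul_basis_eq_zero h0
  exact absurd h (by rw [degree_zero]; exact WithBot.bot_ne_coe)

lemma inftyValuation_X : inftyValuation W (CoordinateRing.mk W (C X)) = WithZero.exp 2 := by
  have h := inftyValuation_smul_basis W (p := X) (q := 0) (n := 2) (by simp)
  simpa [CoordinateRing.smul] using h

lemma inftyValuation_Y : inftyValuation W (CoordinateRing.mk W X) = WithZero.exp 3 := by
  have h := inftyValuation_smul_basis W (p := 0) (q := 1) (n := 3) (by simp)
  simpa using h

/-- The place of the point at infinity. -/
noncomputable def inftyPlace : Place K W.FunctionField :=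
  Place.ofValuation (R := W.CoordinateRing) (inftyValuation W)
    (fun r hr => by rw [inftyValuation_apply W hr]; exact WithZero.exp_ne_zero)
    (fun a ha => by
      have h := inftyValuation_smul_basis W (p := C a) (q := 0) (n := 0)
        (by simp [degree_C ha])
      have e : algebraMap K W.CoordinateRing a = C a • (1 : W.CoordinateRing) := by
        rw [← Algebra.algebraMap_eq_smul_one, IsScalarTower.algebraMap_apply K K[X]]
        rfl
      rw [e]
      simpa using h)
    ⟨CoordinateRing.mk W X, CoordinateRing.mk W (C X),
      fun h0 => by
        have h := inftyValuation_X W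
        rw [h0, map_zero] at h
        exact WithZero.exp_ne_zero h.symm,
      by rw [inftyValuation_X, inftyValuation_Y]; rfl⟩

variable {W} in
lemma isMaximal_XYIdeal {x y : K} (h : W.Nonsingular x y) :
    (CoordinateRing.XYIdeal W x (C y)).IsMaximal := by
  have e := CoordinateRing.quotientXYIdealEquiv (W' := W) (x := x) (y := C y) h.left
  exact Ideal.Quotient.maximal_of_isField _ (e.toMulEquiv.isField (Field.toIsField K))

/-- In a local domain, a factor of a nonzero principal ideal is principal. -/
lemma isPrincipal_of_mul_eq_span {A : Type*} [CommRing A] [IsDomain A] [IsLocalRing A]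
    {I J : Ideal A} {a : A} (ha : a ≠ 0) (h : J * I = Ideal.span {a}) : I.IsPrincipal := by
  have key : ∃ c ∈ J, ∃ b ∈ I, c * b ∉ IsLocalRing.maximalIdeal A * Ideal.span {a} := by
    by_contra! hno
    have h1 : J * I ≤ IsLocalRing.maximalIdeal A * Ideal.span {a} := Ideal.mul_le.mpr hno
    have h2 : a ∈ IsLocalRing.maximalIdeal A * Ideal.span {a} :=
      h1 (h ▸ Ideal.mem_span_singleton_self a)
    obtain ⟨z, hz, hza⟩ := Ideal.mem_mul_span_singleton.mp h2
    have hz1 : z = 1 := mul_right_cancel₀ ha (by rw [hza, one_mul])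
    exact (Ideal.ne_top_iff_one _).mp (IsLocalRing.maximalIdeal.isMaximal A).ne_top (hz1 ▸ hz)
  obtain ⟨c, hc, b, hb, hcb⟩ := key
  obtain ⟨u, hu⟩ := Ideal.mem_span_singleton'.mp (h ▸ Ideal.mul_mem_mul hc hb)
  have hunit : IsUnit u := by
    by_contra hu'
    exact hcb (Ideal.mem_mul_span_singleton.mpr ⟨u, (IsLocalRing.mem_maximalIdeal u).mpr hu', hu⟩)
  have hc0 : c ≠ 0 := by
    rintro rfl
    exact hcb (by simp)
  refine ⟨b, le_antisymm (fun m hm => ?_) ((Ideal.span_singleton_le_iff_mem I).mpr hb)⟩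
  obtain ⟨w, hw⟩ := Ideal.mem_span_singleton'.mp (h ▸ Ideal.mul_mem_mul hc hm)
  obtain ⟨v, hv⟩ := hunit.exists_left_inv
  refine Ideal.mem_span_singleton'.mpr ⟨w * v, mul_left_cancel₀ hc0 ?_⟩
  calc c * (w * v * b) = w * v * (c * b) := by ring
    _ = w * (v * u) * a := by rw [← hu]; ring
    _ = c * m := by rw [hv, mul_one, hw]

instance : IsNoetherianRing W.CoordinateRing :=
  isNoetherianRing_of_surjective _ _ (CoordinateRing.mk W) AdjoinRoot.mk_surjective

variable {W} in
/-- The local ring of the curve at a nonsingular affine point is a discrete valuation ring. -/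
lemma isDiscreteValuationRing_localization {x y : K} (h : W.Nonsingular x y)
    [(CoordinateRing.XYIdeal W x (C y)).IsPrime] :
    IsDiscreteValuationRing (Localization.AtPrime (CoordinateRing.XYIdeal W x (C y))) := by
  set M := CoordinateRing.XYIdeal W x (C y) with hM
  have : IsDomain (Localization.AtPrime M) :=
    IsLocalization.isDomain_localization M.primeCompl_le_nonZeroDivisors
  have : IsNoetherianRing (Localization.AtPrime M) :=
    IsLocalization.isNoetherianRing M.primeCompl _ inferInstance
  have hX : algebraMap W.CoordinateRing (Localization.AtPrime M)
      (CoordinateRing.XClass W x) ≠ 0 := by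
    rw [Ne, IsLocalization.to_map_eq_zero_iff _ M.primeCompl_le_nonZeroDivisors]
    exact CoordinateRing.XClass_ne_zero x
  have hmax : M.map (algebraMap W.CoordinateRing (Localization.AtPrime M)) =
      IsLocalRing.maximalIdeal _ := Localization.AtPrime.map_eq_maximalIdeal
  have hXM : algebraMap W.CoordinateRing (Localization.AtPrime M) (CoordinateRing.XClass W x) ∈
      IsLocalRing.maximalIdeal (Localization.AtPrime M) := by
    rw [← hmax]
    exact Ideal.mem_map_of_mem _ (Ideal.subset_span (by simp))
  have hfield : ¬ IsField (Localization.AtPrime M) := by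
    rw [IsLocalRing.isField_iff_maximalIdeal_eq]
    intro h0
    rw [h0] at hXM
    exact hX hXM
  refine ((IsDiscreteValuationRing.TFAE _ hfield).out 0 4).mpr ?_
  have hmul := congrArg (Ideal.map (algebraMap W.CoordinateRing (Localization.AtPrime M)))
    (CoordinateRing.XYIdeal_neg_mul h)
  rw [Ideal.map_mul, ← hM, hmax, CoordinateRing.XIdeal, Ideal.map_span, Set.image_singleton] at hmul
  exact isPrincipal_of_mul_eq_span hX hmul

variable {W} in
/-- The order of vanishing at a nonsingular affine point `(x, y)`, on the coordinate ring: the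
valuation of the local ring of the curve at the maximal ideal `⟨X - x, Y - y⟩`. -/
noncomputable def affineValuation {x y : K} (h : W.Nonsingular x y) :
    Valuation W.CoordinateRing ℤᵐ⁰ :=
  haveI := (isMaximal_XYIdeal h).isPrime
  haveI := isDiscreteValuationRing_localization h
  ((IsDiscreteValuationRing.maximalIdeal
    (Localization.AtPrime (CoordinateRing.XYIdeal W x (C y)))).intValuation).comap
      (algebraMap W.CoordinateRing _)

variable {W} in
lemma affineValuation_ne_zero {x y : K} (h : W.Nonsingular x y) {r : W.CoordinateRing}
    (hr : r ≠ 0) : affineValuation h r ≠ 0 := by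
  have := (isMaximal_XYIdeal h).isPrime
  have := isDiscreteValuationRing_localization h
  refine IsDedekindDomain.HeightOneSpectrum.intValuation_ne_zero _ _ ?_
  rwa [Ne, IsLocalization.to_map_eq_zero_iff _
    (CoordinateRing.XYIdeal W x (C y)).primeCompl_le_nonZeroDivisors]

variable {W} in
lemma affineValuation_lt_one_iff {x y : K} (h : W.Nonsingular x y) {r : W.CoordinateRing} :
    affineValuation h r < 1 ↔ r ∈ CoordinateRing.XYIdeal W x (C y) := by
  have := (isMaximal_XYIdeal h).isPrime
  have := isDiscreteValuationRing_localization h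
  exact (IsDedekindDomain.HeightOneSpectrum.intValuation_lt_one_iff_mem _ _).trans
    (IsLocalization.AtPrime.to_map_mem_maximal_iff _ (CoordinateRing.XYIdeal W x (C y)) r)

variable {W} in
lemma affineValuation_eq_one {x y : K} (h : W.Nonsingular x y) {r : W.CoordinateRing}
    (hr : r ∉ CoordinateRing.XYIdeal W x (C y)) : affineValuation h r = 1 := by
  have := (isMaximal_XYIdeal h).isPrime
  have := isDiscreteValuationRing_localization h
  refine le_antisymm (IsDedekindDomain.HeightOneSpectrum.intValuation_le_one _ _) ?_
  exact not_lt.mp fun hlt => hr ((affineValuation_lt_one_iff h).mp hlt)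

variable {W} in
lemma exists_affineValuation_eq {x y : K} (h : W.Nonsingular x y) :
    ∃ r : W.CoordinateRing, affineValuation h r = WithZero.exp (-1) := by
  have := (isMaximal_XYIdeal h).isPrime
  have := isDiscreteValuationRing_localization h
  obtain ⟨f, hf⟩ := (IsDiscreteValuationRing.maximalIdeal (Localization.AtPrime
    (CoordinateRing.XYIdeal W x (C y)))).intValuation_exists_uniformizer
  obtain ⟨⟨r, s⟩, hrs⟩ :=
    IsLocalization.surj (CoordinateRing.XYIdeal W x (C y)).primeCompl f
  refine ⟨r, ?_⟩
  have hs := affineValuation_eq_one h s.2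
  have h2 := congrArg (IsDiscreteValuationRing.maximalIdeal (Localization.AtPrime
    (CoordinateRing.XYIdeal W x (C y)))).intValuation hrs
  rw [map_mul, hf] at h2
  refine h2.symm.trans ?_
  exact (congrArg (WithZero.exp (-1 : ℤ) * ·) hs).trans (mul_one _)

variable {W} in
/-- The place of a nonsingular affine point. -/
noncomputable def affinePlace {x y : K} (h : W.Nonsingular x y) : Place K W.FunctionField :=
  Place.ofValuation (R := W.CoordinateRing) (affineValuation h)
    (fun _ hr => affineValuation_ne_zero h hr)
    (fun a ha => affineValuation_eq_one h fun hmem =>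
      (isMaximal_XYIdeal h).ne_top (Ideal.eq_top_of_isUnit_mem _ hmem
        ((IsUnit.mk0 a ha).map (algebraMap K W.CoordinateRing))))
    (by
      obtain ⟨r, hr⟩ := exists_affineValuation_eq h
      refine ⟨1, r, ?_, ?_⟩
      · rintro rfl
        rw [map_zero] at hr
        exact WithZero.exp_ne_zero hr.symm
      · rw [hr, map_one, ← WithZero.exp_add]
        rfl)

/-- The place of a rational point. -/
noncomputable def placeOf : W.Point → Place K W.FunctionField
  | .zero => inftyPlace W
  | .some _ _ h => affinePlace h

variable {W} in
/-- The value of the function `X` at the place of an affine point is the `x`-coordinate. -/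
lemma eval_placeOf_funX {x y : K} (h : W.Nonsingular x y) :
    (placeOf W (.some x y h)).eval (funX W) = x := by
  refine Place.eval_eq_of_lt ?_
  have e : funX W - algebraMap K W.FunctionField x =
      algebraMap W.CoordinateRing W.FunctionField (CoordinateRing.XClass W x) := by
    have e' : CoordinateRing.XClass W x =
        CoordinateRing.mk W (C X) - algebraMap K W.CoordinateRing x := by
      rw [CoordinateRing.XClass, C_sub, map_sub, IsScalarTower.algebraMap_apply K K[X]]
      rfl
    rw [e', map_sub, ← IsScalarTower.algebraMap_apply K W.CoordinateRing W.FunctionField]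
    rfl
  rw [e]
  refine (Valuation.extendToLocalization_apply_map_apply (affineValuation h)
    (nonZeroDivisors_le_primeCompl_supp _ fun _ => affineValuation_ne_zero h) W.FunctionField
    (CoordinateRing.XClass W x)).trans_lt ((affineValuation_lt_one_iff h).mpr ?_)
  exact Ideal.subset_span (by simp)

/-- The divisor `∑ t_z ∑_{P ∈ Orb_σ(Q_z)} P - c P_∞`. -/
noncomputable def orbitDivisor (σ : W.FunctionField ≃ₐ[K] W.FunctionField) {s : ℕ}
    (Q : Fin s → W.Point) (t : Fin s → ℤ) (c : ℤ) : Divisor K W.FunctionField :=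
  (∑ z, t z • ∑ P ∈ Place.orbit σ (placeOf W (Q z)), Finsupp.single P 1) -
    c • Finsupp.single (inftyPlace W) 1

/-- The function `X^i Y^j / ∏_z (∏_ρ (X - x(Q_{z,ρ})))^{t_z}`, where `Q_{z,1}, …, Q_{z,ℓ/2}` are the
first `ℓ / 2` points `Q_z, σ(Q_z), …` of the orbit of `Q_z` under `σ`, with `ℓ` the order of `σ`. -/
noncomputable def orbitFunction (σ : W.FunctionField ≃ₐ[K] W.FunctionField) {s : ℕ}
    (Q : Fin s → W.Point) (t : Fin s → ℤ) (i j : ℕ) : W.FunctionField :=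
  funX W ^ i * funY W ^ j /
    ∏ z, (∏ ρ ∈ Finset.range (orderOf σ / 2),
      (funX W - algebraMap K W.FunctionField ((σ ^ ρ • placeOf W (Q z)).eval (funX W)))) ^ t z

end EllipticPlaces

/-! The proof finds a function `H` with `div H = G - n P_∞`, where `n = ℓ ∑ t_z - c`. Then `f ∈
L(G)` if and only if `f H ∈ L(n P_∞)`, and everything reduces to a space with a pole at infinity
only; the Riemann-Roch theorem is not needed.

Computing `L(n P_∞)`: smoothness makes the coordinate ring integrally closed, hence Dedekind, so the
functions regular away from `P_∞` are exactly its elements `p(X) + q(X) Y` (`exists_algebraMap_eq`).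
The summands have pole orders `2 deg p` and `2 deg q + 3` at `P_∞`. Their parities differ, so
nothing cancels and a bound on the pole order is a bound on both degrees
(`inftyPlace_val_aeval_le_iff`).

The function `H` is the common denominator. For a point `P` that is not 2-torsion, `div (X - x(P)) =
P + (-P) - 2 P_∞` (`ord_funX_sub`). The power `σ ^ (ℓ/2)` is a nontrivial involution fixing `P_∞`.
Comparing coefficients in the Weierstrass equation shows that it fixes `X`, so it is negation
(`smul_affinePlace_of_involution`). Hence the orbit of `Q_z` splits into pairs `±σ^ρ(Q_z)` with `ρ <
ℓ/2`, and `∏_ρ (X - x(σ^ρ Q_z))` has divisor "orbit minus `ℓ P_∞`" (`ord_prod_funX_sub`).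

The orbit must have `ℓ` distinct points. A nontrivial stabilizer would contain an element of order
2, whose fixed points are 2-torsion, or of order 3, whose fixed points are 3-torsion
(`three_nsmul_eq_zero_of_smul_affinePlace_eq`). Both are excluded.

Places are arbitrary normalized valuations, so these divisors are checked at every place. This
requires recognizing the place at infinity (`eq_inftyPlace`) and those of affine points
(`eq_affinePlace`). -/

namespace EllipticPlaces

open Polynomial WeierstrassCurve.Affine AlgFunField

/-! ### The coordinate ring of an elliptic curve is a Dedekind domain -/

section Dedekind

variable {K : Type*} [Field K] (W : WeierstrassCurve.Affine K)

/-- The coefficient of `Y` in the Weierstrass equation. -/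
noncomputable def linCoeff : K[X] := C W.a₁ * X + C W.a₃

/-- The right-hand side of the Weierstrass equation. -/
noncomputable def cubic : K[X] := X ^ 3 + C W.a₂ * X ^ 2 + C W.a₄ * X + C W.a₆

lemma mk_Y_sq : CoordinateRing.mk W X ^ 2 =
    algebraMap K[X] W.CoordinateRing (cubic W) -
      algebraMap K[X] W.CoordinateRing (linCoeff W) * CoordinateRing.mk W X := by
  have h := CoordinateRing.smul_basis_mul_Y (W' := W) 0 1
  rw [zero_smul, zero_add, one_smul, ← sq, one_mul, zero_sub, one_mul] at h
  rw [h, Algebra.smul_def, Algebra.smul_def, mul_one, map_neg, neg_mul, ← sub_eq_add_neg]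
  rfl

/-- There is no singular point of an elliptic curve over a residue field of `K[X]`. -/
lemma not_sq_dvd_of_irreducible [W.IsElliptic] {π y : K[X]} (hπ : Irreducible π)
    (h1 : π ^ 2 ∣ y ^ 2 + y * linCoeff W - cubic W) : ¬ π ∣ 2 * y + linCoeff W := by
  intro h2
  -- With `F` the Weierstrass polynomial, `π` divides the derivative `F_X + y' F_Y` of `F(X, y(X))`.
  -- It also divides `F_Y = 2y + a₁X + a₃`, hence `F_X`. So `(X, y)` modulo `π` is a singular point
  -- over `K[X]/π`.
  have hder : π ∣ derivative (y ^ 2 + y * linCoeff W - cubic W) := by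
    obtain ⟨g, hg⟩ := h1
    rw [hg, derivative_mul, derivative_pow]
    exact dvd_add (Dvd.dvd.mul_right (Dvd.dvd.mul_right (by simp) _) _)
      (Dvd.dvd.mul_right (dvd_pow_self _ two_ne_zero) _)
  have h3 : π ∣ y * C W.a₁ - (3 * X ^ 2 + 2 * C W.a₂ * X + C W.a₄) := by
    have e : y * C W.a₁ - (3 * X ^ 2 + 2 * C W.a₂ * X + C W.a₄) =
        derivative (y ^ 2 + y * linCoeff W - cubic W) -
          derivative y * (2 * y + linCoeff W) := by
      simp only [linCoeff, cubic, derivative_sub, derivative_add, derivative_mul, derivative_pow,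
        derivative_C, derivative_X, Nat.cast_ofNat, map_ofNat]
      ring
    rw [e]
    exact dvd_sub hder (h2.mul_left _)
  have := Fact.mk hπ
  have hW : (W.map (algebraMap K (AdjoinRoot π))).toAffine.Equation (AdjoinRoot.root π)
      (AdjoinRoot.mk π y) := by
    rw [WeierstrassCurve.Affine.equation_iff']
    have h := AdjoinRoot.mk_eq_zero.mpr ((dvd_pow_self π two_ne_zero).trans h1)
    simp only [linCoeff, cubic, map_sub, map_add, map_mul, map_pow, AdjoinRoot.mk_X,
      AdjoinRoot.mk_C] at h
    simp only [WeierstrassCurve.map_a₁, WeierstrassCurve.map_a₂, WeierstrassCurve.map_a₃,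
      WeierstrassCurve.map_a₄, WeierstrassCurve.map_a₆, AdjoinRoot.algebraMap_eq]
    linear_combination h
  rw [WeierstrassCurve.Affine.equation_iff_nonsingular,
    WeierstrassCurve.Affine.nonsingular_iff'] at hW
  have e3 := AdjoinRoot.mk_eq_zero.mpr h3
  have e2 := AdjoinRoot.mk_eq_zero.mpr h2
  simp only [linCoeff, map_sub, map_add, map_mul, map_pow, AdjoinRoot.mk_X, AdjoinRoot.mk_C,
    map_ofNat] at e2 e3
  simp only [WeierstrassCurve.map_a₁, WeierstrassCurve.map_a₂, WeierstrassCurve.map_a₃,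
      WeierstrassCurve.map_a₄, AdjoinRoot.algebraMap_eq] at hW
  rcases hW.2 with h | h
  · exact h (by linear_combination e3)
  · exact h (by linear_combination e2)

/-- The two hypotheses concern the trace and the norm of `p + qY` over `K[X]`. If `π ∤ q`, then `y =
-p/q` modulo `π²` satisfies `F(y) = norm / q²` and `F_Y(y) = -trace / q`, which contradicts
smoothness. -/
lemma dvd_of_dvd_trace_of_sq_dvd_norm [W.IsElliptic] {π p q : K[X]} (hπ : Irreducible π)
    (ht : π ∣ 2 * p - q * linCoeff W)
    (hn : π ^ 2 ∣ p ^ 2 - p * q * linCoeff W - q ^ 2 * cubic W) : π ∣ p ∧ π ∣ q := by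
  by_cases hq : π ∣ q
  · refine ⟨hπ.prime.dvd_of_dvd_pow (n := 2) ?_, hq⟩
    have h1 := (dvd_pow_self π two_ne_zero).trans hn
    have e : p ^ 2 = (p ^ 2 - p * q * linCoeff W - q ^ 2 * cubic W) +
      q * (p * linCoeff W + q * cubic W) := by ring
    rw [e]
    exact dvd_add h1 (hq.mul_right _)
  · exfalso
    have hc : IsCoprime π q := (hπ.coprime_iff_not_dvd).mpr hq
    obtain ⟨u, v, huv⟩ := hc.pow_left (m := 2)
    -- `v` is an inverse of `q` modulo `π²`.
    refine not_sq_dvd_of_irreducible W hπ (y := -p * v) ?_ ?_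
    · refine (hc.pow (m := 2) (n := 2)).dvd_of_dvd_mul_left ?_
      obtain ⟨g, hg⟩ := hn
      refine ⟨g + u * p * (u * π ^ 2 * p - 2 * p + q * linCoeff W), ?_⟩
      have hv : v * q = 1 - u * π ^ 2 := by linear_combination huv
      linear_combination hg + (p ^ 2 * (v * q + 1 - u * π ^ 2) - p * q * linCoeff W) * hv
    · refine hc.dvd_of_dvd_mul_left ?_
      obtain ⟨g, hg⟩ := ht
      refine ⟨-g + 2 * p * u * π, ?_⟩
      linear_combination -hg - 2 * p * huv

instance : Module.Finite K[X] W.CoordinateRing := .of_basis (CoordinateRing.basis W)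

/-- `z` is a root of `π² T² - π t T + n`, with `t` and `n` the trace and norm of `p + qY`, and its
minimal polynomial over `K[X]` divides this quadratic. If it is linear, then `z ∈ K[X]` and the
claim is read off; otherwise the cofactor is the constant `π²`, so `π ∣ t` and `π² ∣ n`. -/
lemma dvd_of_isIntegral [W.IsElliptic] {π p q : K[X]} (hπ : Irreducible π) {z : W.FunctionField}
    (hz : IsIntegral K[X] z) (h : algebraMap K[X] W.FunctionField π * z =
      algebraMap W.CoordinateRing W.FunctionField
        (p • (1 : W.CoordinateRing) + q • CoordinateRing.mk W X)) : π ∣ p ∧ π ∣ q := by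
  have hπ0 := hπ.ne_zero
  set t := 2 * p - q * linCoeff W
  set n := p ^ 2 - p * q * linCoeff W - q ^ 2 * cubic W
  set P : K[X][X] := C (π ^ 2) * X ^ 2 + C (-(π * t)) * X + C n with hP
  have hdeg : P.natDegree = 2 := natDegree_quadratic (pow_ne_zero 2 hπ0)
  have hlead : P.leadingCoeff = π ^ 2 := leadingCoeff_quadratic (pow_ne_zero 2 hπ0)
  have hPz : aeval z P = 0 := by
    simp only [hP, map_add, map_mul, aeval_C, map_pow, aeval_X]
    have hY := congrArg (algebraMap W.CoordinateRing W.FunctionField) (mk_Y_sq W)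
    simp only [map_sub, map_mul, map_pow, ← IsScalarTower.algebraMap_apply K[X]] at hY
    simp only [map_add, Algebra.smul_def, map_mul, mul_one,
      ← IsScalarTower.algebraMap_apply K[X]] at h
    simp only [t, n, map_sub, map_mul, map_pow, map_neg, map_ofNat]
    generalize algebraMap W.CoordinateRing W.FunctionField (CoordinateRing.mk W X) = Y at *
    linear_combination (algebraMap K[X] W.FunctionField π * z +
      algebraMap K[X] W.FunctionField p + algebraMap K[X] W.FunctionField q * Y -
      (2 * algebraMap K[X] W.FunctionField p - algebraMap K[X] W.FunctionField q *
        algebraMap K[X] W.FunctionField (linCoeff W))) * h +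
      (algebraMap K[X] W.FunctionField q) ^ 2 * hY
  obtain ⟨u, hu⟩ := minpoly.isIntegrallyClosed_dvd hz hPz
  have hm := minpoly.monic hz
  have hm0 := minpoly.natDegree_pos hz
  have hu0 : u ≠ 0 := by
    rintro rfl
    rw [mul_zero] at hu
    rw [hu, natDegree_zero] at hdeg
    omega
  have hdeg' : (minpoly K[X] z).natDegree + u.natDegree = 2 := by
    rw [← hdeg, hu, hm.natDegree_mul' hu0]
  have hlead' : u.leadingCoeff = π ^ 2 := by
    rw [← hlead, hu, leadingCoeff_mul, hm.leadingCoeff, one_mul]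
  obtain hm1 | hm2 : (minpoly K[X] z).natDegree = 1 ∨ u.natDegree = 0 := by omega
  · have hz' : z = algebraMap K[X] W.FunctionField (-(minpoly K[X] z).coeff 0) := by
      have h0 := minpoly.aeval K[X] z
      rw [hm.eq_X_add_C hm1] at h0
      simp only [map_add, aeval_X, aeval_C] at h0
      rw [map_neg]
      linear_combination h0
    set a := -(minpoly K[X] z).coeff 0
    have h0 : (p - π * a) • (1 : W.CoordinateRing) + q • CoordinateRing.mk W X = 0 := by
      apply IsFractionRing.injective W.CoordinateRing W.FunctionField
      rw [hz', ← map_mul, IsScalarTower.algebraMap_apply K[X] W.CoordinateRing] at h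
      rw [sub_smul, sub_add_eq_add_sub, map_sub, ← h, map_zero, ← Algebra.algebraMap_eq_smul_one,
        sub_self]
    obtain ⟨h1, rfl⟩ := CoordinateRing.smul_basis_eq_zero h0
    exact ⟨⟨a, sub_eq_zero.mp h1⟩, dvd_zero _⟩
  · rw [eq_C_of_natDegree_eq_zero hm2] at hu hlead'
    rw [leadingCoeff_C] at hlead'
    rw [hlead'] at hu
    have c0 := congrArg (fun f => coeff f 0) hu
    have c1 := congrArg (fun f => coeff f 1) hu
    simp only [hP, coeff_add, coeff_C_mul, coeff_mul_C, coeff_X_pow, coeff_X, coeff_C] at c0 c1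
    norm_num at c0 c1
    refine dvd_of_dvd_trace_of_sq_dvd_norm W hπ (p := p) (q := q)
      ⟨-(minpoly K[X] z).coeff 1, mul_left_cancel₀ hπ0 ?_⟩
      ⟨(minpoly K[X] z).coeff 0, ?_⟩
    · linear_combination -c1
    · linear_combination c0

/-- The irreducible factors of the denominator `d` are cancelled one at a time. -/
lemma mem_range_of_isIntegral [W.IsElliptic] {d : K[X]} (hd : d ≠ 0) :
    ∀ {z : W.FunctionField} {r : W.CoordinateRing}, IsIntegral K[X] z →
      algebraMap K[X] W.FunctionField d * z = algebraMap W.CoordinateRing W.FunctionField r →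
      ∃ s, algebraMap W.CoordinateRing W.FunctionField s = z := by
  induction d using WfDvdMonoid.induction_on_irreducible with
  | zero => exact absurd rfl hd
  | unit u hu =>
    intro z r _ h
    obtain ⟨v, hv⟩ := hu.exists_left_inv
    refine ⟨algebraMap K[X] W.CoordinateRing v * r, ?_⟩
    rw [map_mul, ← h, ← IsScalarTower.algebraMap_apply, ← mul_assoc, ← map_mul, hv, map_one,
      one_mul]
  | mul d π hd0 hπ ih =>
    intro z r hz h
    obtain ⟨p, q, rfl⟩ := CoordinateRing.exists_smul_basis_eq r
    rw [map_mul, mul_assoc] at h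
    obtain ⟨⟨p, rfl⟩, ⟨q, rfl⟩⟩ := dvd_of_isIntegral W hπ (isIntegral_algebraMap.mul hz) h
    refine ih hd0 (r := p • (1 : W.CoordinateRing) + q • CoordinateRing.mk W X) hz ?_
    have hπ0 : algebraMap K[X] W.FunctionField π ≠ 0 := by
      rw [IsScalarTower.algebraMap_apply K[X] W.CoordinateRing]
      exact (map_ne_zero_iff _ (IsFractionRing.injective _ _)).mpr
        ((map_ne_zero_iff _ (FaithfulSMul.algebraMap_injective _ _)).mpr hπ.ne_zero)
    apply mul_left_cancel₀ hπ0
    rw [h, mul_smul, mul_smul, ← smul_add, Algebra.smul_def, map_mul,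
      ← IsScalarTower.algebraMap_apply]

instance [W.IsElliptic] : IsIntegrallyClosed W.CoordinateRing := by
  refine (isIntegrallyClosed_iff W.FunctionField).mpr fun {z} hz => ?_
  have hz' : IsIntegral K[X] z := isIntegral_trans z hz
  obtain ⟨⟨r, s⟩, hrs⟩ := IsLocalization.surj (nonZeroDivisors W.CoordinateRing) z
  have hs : (s : W.CoordinateRing) ≠ 0 := nonZeroDivisors.coe_ne_zero s
  -- The coordinate ring is integral over `K[X]`, so the denominator `s` divides a nonzero
  -- polynomial in `X`.
  obtain ⟨d, hd0, c, hc⟩ : ∃ d : K[X], d ≠ 0 ∧ ∃ c : W.CoordinateRing,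
      algebraMap K[X] W.CoordinateRing d = c * s := by
    obtain ⟨d, hd, hd0⟩ := Submodule.exists_mem_ne_zero_of_ne_bot
      (Ideal.IsIntegral.comap_ne_bot K[X] (I := Ideal.span {(s : W.CoordinateRing)}) (by simp))
    obtain ⟨c, hc⟩ := Ideal.mem_span_singleton'.mp (Ideal.mem_comap.mp hd)
    exact ⟨d, hd0, c, hc.symm⟩
  refine mem_range_of_isIntegral W hd0 (r := c * r) hz' ?_
  rw [IsScalarTower.algebraMap_apply K[X] W.CoordinateRing, hc, map_mul, map_mul, ← hrs]
  ring

instance [W.IsElliptic] : IsDedekindDomain W.CoordinateRing :=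
  have : Algebra.IsIntegral K[X] W.CoordinateRing := inferInstance
  have : Ring.DimensionLEOne W.CoordinateRing := .of_isIntegral K[X] _
  { }

end Dedekind

end EllipticPlaces

/-! ### Comparison of places, and rational places. -/

namespace AlgFunField

namespace Place

variable {K F : Type*} [Field K] [Field F] [Algebra K F]

instance (P : Place K F) : P.val.IsTrivialOn K := ⟨P.val_algebraMap⟩

lemma ofValuation_val_algebraMap {R : Type*} [CommRing R] [IsDomain R] [Algebra K R]
    [Algebra R F] [IsScalarTower K R F] [IsFractionRing R F] {v : Valuation R ℤᵐ⁰}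
    (hv : ∀ r : R, r ≠ 0 → v r ≠ 0) (hK : ∀ a : K, a ≠ 0 → v (algebraMap K R a) = 1)
    (h1 : ∃ a b : R, b ≠ 0 ∧ v a = WithZero.exp 1 * v b) (r : R) :
    (ofValuation (F := F) v hv hK h1).val (algebraMap R F r) = v r :=
  Valuation.extendToLocalization_apply_map_apply v
    (nonZeroDivisors_le_primeCompl_supp _ hv) F r

lemma ext_of_algebraMap (R : Type*) [CommRing R] [IsDomain R] [Algebra R F] [IsFractionRing R F]
    {P P' : Place K F}
    (h : ∀ r : R, P.val (algebraMap R F r) = P'.val (algebraMap R F r)) : P = P' := by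
  ext f
  obtain ⟨a, b, _, rfl⟩ := IsFractionRing.div_surjective (A := R) f
  rw [map_div₀, map_div₀, h, h]

/-- If the values of a place on a ring with fraction field `F` are powers of `exp e`, where `e` is
positive, then `e = 1`. -/
lemma eq_one_of_val_eq_exp (R : Type*) [CommRing R] [IsDomain R] [Algebra R F]
    [IsFractionRing R F] (P : Place K F) {e : ℤ} (he : 0 ≤ e) (n : R → ℤ)
    (h : ∀ r : R, r ≠ 0 → P.val (algebraMap R F r) = WithZero.exp (e * n r)) : e = 1 := by
  -- Normalization: the value `exp 1` is attained, so `e` divides `1`.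
  obtain ⟨f, hf⟩ := P.surjective_val (WithZero.exp 1)
  obtain ⟨a, b, hb, rfl⟩ := IsFractionRing.div_surjective (A := R) f
  have hb0 : b ≠ 0 := nonZeroDivisors.ne_zero hb
  have ha0 : a ≠ 0 := by
    rintro rfl
    rw [map_zero, zero_div, map_zero] at hf
    exact WithZero.exp_ne_zero hf.symm
  rw [map_div₀, h a ha0, h b hb0, ← WithZero.exp_sub, WithZero.exp_inj, ← mul_sub] at hf
  exact Int.eq_one_of_mul_eq_one_right he hf

/-- A place is rational if every function without pole has a value in the constant field. -/
def IsRational (P : Place K F) : Prop :=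
  ∀ f : F, P.val f ≤ 1 → ∃ a : K, P.val (f - algebraMap K F a) < 1

lemma IsRational.smul {P : Place K F} (hP : P.IsRational) (σ : F ≃ₐ[K] F) :
    (σ • P).IsRational := fun f hf => by
  obtain ⟨a, ha⟩ := hP (σ.symm f) hf
  exact ⟨a, by rwa [smul_val, map_sub, AlgEquiv.commutes]⟩

lemma IsRational.degree_eq_one {P : Place K F} (hP : P.IsRational) : P.degree = 1 := by
  have h1 : (1 : F) ∈ P.localRing := P.val.map_one.le
  refine finrank_eq_one (Submodule.Quotient.mk ⟨1, h1⟩) ?_ fun w => ?_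
  · rw [Ne, Submodule.Quotient.mk_eq_zero]
    exact fun h => (lt_irrefl _ (P.val.map_one ▸ (show P.val 1 < 1 from h)))
  · obtain ⟨⟨f, hf⟩, rfl⟩ := Submodule.Quotient.mk_surjective _ w
    obtain ⟨a, ha⟩ := hP f hf
    refine ⟨a, ?_⟩
    rw [← Submodule.Quotient.mk_smul, eq_comm, Submodule.Quotient.eq]
    change P.val (f - a • (1 : F)) < 1
    rwa [← Algebra.algebraMap_eq_smul_one]

end Place

end AlgFunField

namespace EllipticPlaces

open Polynomial WeierstrassCurve.Affine AlgFunField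

/-! ### Functions as `p(X) + q(X) Y`, and their values at places. -/

section Places

variable {K : Type*} [Field K] (W : WeierstrassCurve.Affine K)

lemma inftyPlace_val (r : W.CoordinateRing) :
    (inftyPlace W).val (algebraMap W.CoordinateRing W.FunctionField r) = inftyValuation W r :=
  Place.ofValuation_val_algebraMap _ _ _ r

variable {W} in
lemma affinePlace_val {x y : K} (h : W.Nonsingular x y) (r : W.CoordinateRing) :
    (affinePlace h).val (algebraMap W.CoordinateRing W.FunctionField r) = affineValuation h r :=
  Place.ofValuation_val_algebraMap _ _ _ r

lemma algebraMap_smul_basis (p q : K[X]) :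
    algebraMap W.CoordinateRing W.FunctionField
      (p • (1 : W.CoordinateRing) + q • CoordinateRing.mk W X) =
      aeval (funX W) p + aeval (funX W) q * funY W := by
  have h (p : K[X]) : algebraMap W.CoordinateRing W.FunctionField
      (algebraMap K[X] W.CoordinateRing p) = aeval (funX W) p := by
    induction p using Polynomial.induction_on' with
    | add p q hp hq => simp only [map_add, hp, hq]
    | monomial n a =>
      rw [aeval_monomial, ← C_mul_X_pow_eq_monomial, map_mul, map_mul, map_pow, map_pow,
        IsScalarTower.algebraMap_apply K W.CoordinateRing W.FunctionField]
      rfl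
  rw [map_add, Algebra.smul_def, Algebra.smul_def, mul_one, map_mul, h, h]
  rfl

lemma exists_aeval_eq (r : W.CoordinateRing) : ∃ p q : K[X],
    algebraMap W.CoordinateRing W.FunctionField r =
      aeval (funX W) p + aeval (funX W) q * funY W := by
  obtain ⟨p, q, rfl⟩ := CoordinateRing.exists_smul_basis_eq r
  exact ⟨p, q, algebraMap_smul_basis W p q⟩

lemma aeval_eq_zero {p q : K[X]} (h : aeval (funX W) p + aeval (funX W) q * funY W = 0) :
    p = 0 ∧ q = 0 := by
  rw [← algebraMap_smul_basis, map_eq_zero_iff _ (IsFractionRing.injective _ _)] at h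
  exact CoordinateRing.smul_basis_eq_zero h

lemma funY_sq : funY W ^ 2 + aeval (funX W) (linCoeff W) * funY W = aeval (funX W) (cubic W) := by
  have h := congrArg (algebraMap W.CoordinateRing W.FunctionField)
    (CoordinateRing.smul_basis_mul_Y (W' := W) 0 1)
  rw [map_mul, algebraMap_smul_basis, algebraMap_smul_basis] at h
  simp only [map_zero, map_one, one_mul, zero_sub, map_neg, zero_add] at h
  change funY W * funY W = aeval (funX W) (cubic W) + -aeval (funX W) (linCoeff W) * funY W at h
  linear_combination h

lemma equation_fun : funY W ^ 2 + algebraMap K _ W.a₁ * funX W * funY W +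
    algebraMap K _ W.a₃ * funY W = funX W ^ 3 + algebraMap K _ W.a₂ * funX W ^ 2 +
      algebraMap K _ W.a₄ * funX W + algebraMap K _ W.a₆ := by
  have h := funY_sq W
  simp only [linCoeff, cubic, map_add, map_mul, map_pow, aeval_X, aeval_C] at h
  linear_combination h

variable {W} in
lemma val_aeval_le_one {P : Place K W.FunctionField} {f : W.FunctionField} (h : P.val f ≤ 1)
    (p : K[X]) : P.val (aeval f p) ≤ 1 := by
  induction p using Polynomial.induction_on' with
  | add p q hp hq => rw [map_add]; exact (P.val.map_add _ _).trans (max_le hp hq)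
  | monomial n a =>
    rw [aeval_monomial, map_mul, map_pow]
    exact mul_le_one' (P.val_algebraMap_le_one a) (pow_le_one₀ zero_le h)

variable {W} in
-- `Y` is integral over `K[X]`: if its value exceeded 1, the Weierstrass equation would bound the
-- square of this value by the value itself.
lemma val_funY_le_one {P : Place K W.FunctionField} (h : P.val (funX W) ≤ 1) :
    P.val (funY W) ≤ 1 := by
  by_contra! hY
  have h1 : funY W ^ 2 = aeval (funX W) (cubic W) - aeval (funX W) (linCoeff W) * funY W := by
    linear_combination funY_sq W
  have h2 : P.val (funY W) ^ 2 ≤ P.val (funY W) := by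
    rw [← map_pow, h1]
    refine (P.val.map_sub _ _).trans (max_le ((val_aeval_le_one h _).trans hY.le) ?_)
    rw [map_mul]
    exact mul_le_of_le_one_left' (val_aeval_le_one h _)
  have h3 := lt_self_pow₀ hY one_lt_two
  exact absurd h2 h3.not_ge

variable {W} in
lemma val_algebraMap_le_one {P : Place K W.FunctionField} (h : P.val (funX W) ≤ 1)
    (r : W.CoordinateRing) : P.val (algebraMap W.CoordinateRing W.FunctionField r) ≤ 1 := by
  obtain ⟨p, q, hr⟩ := exists_aeval_eq W r
  rw [hr]
  refine (P.val.map_add _ _).trans (max_le (val_aeval_le_one h _) ?_)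
  rw [map_mul]
  exact mul_le_one' (val_aeval_le_one h _) (val_funY_le_one h)

/-! ### The place at infinity -/

lemma inftyPlace_val_funX : (inftyPlace W).val (funX W) = WithZero.exp 2 :=
  (inftyPlace_val W _).trans (inftyValuation_X W)

lemma inftyPlace_val_funY : (inftyPlace W).val (funY W) = WithZero.exp 3 :=
  (inftyPlace_val W _).trans (inftyValuation_Y W)

variable {W} in
lemma val_aeval_of_one_lt {P : Place K W.FunctionField} (h : 1 < P.val (funX W)) {p : K[X]}
    (hp : p ≠ 0) : P.val (aeval (funX W) p) = P.val (funX W) ^ p.natDegree :=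
  Polynomial.valuation_aeval_eq_valuation_X_pow_natDegree_of_one_lt_valuation_X _ h hp

lemma natDegree_cubic : (cubic W).natDegree = 3 := by
  unfold cubic; compute_degree!

lemma natDegree_linCoeff_le : (linCoeff W).natDegree ≤ 1 := by
  unfold linCoeff; compute_degree

variable {W} in
-- The cubic has the value of its leading term. If `Y` did not exceed `X` in value, the left-hand
-- side of the Weierstrass equation would be at most `v(X)²`, too small. So `Y²` dominates that
-- side.
lemma val_funY_sq_of_one_lt {P : Place K W.FunctionField} (h : 1 < P.val (funX W)) :
    P.val (funY W) ^ 2 = P.val (funX W) ^ 3 := by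
  have hB : P.val (aeval (funX W) (cubic W)) = P.val (funX W) ^ 3 := by
    rw [val_aeval_of_one_lt h, natDegree_cubic]
    exact ne_zero_of_natDegree_gt (natDegree_cubic W ▸ zero_lt_three)
  have hA : P.val (aeval (funX W) (linCoeff W)) ≤ P.val (funX W) := by
    by_cases h0 : linCoeff W = 0
    · simp [h0]
    · rw [val_aeval_of_one_lt h h0]
      exact (pow_le_pow_right₀ h.le (natDegree_linCoeff_le W)).trans_eq (pow_one _)
  have hY : P.val (funX W) < P.val (funY W) := by
    by_contra! hY
    have h1 : P.val (funX W) ^ 3 ≤ P.val (funX W) ^ 2 := by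
      rw [← hB, ← funY_sq]
      refine (P.val.map_add _ _).trans (max_le ?_ ?_)
      · rw [map_pow]
        exact pow_le_pow_left₀ zero_le hY 2
      · rw [map_mul, sq]
        exact mul_le_mul' hA hY
    exact absurd h1 (pow_lt_pow_right₀ h (by norm_num)).not_ge
  rw [← hB, ← funY_sq, Valuation.map_add_eq_of_lt_left, map_pow]
  rw [map_mul, map_pow, sq]
  exact mul_lt_mul_of_pos_right (hA.trans_lt hY) (zero_le.trans_lt hY)

open Classical in
lemma inftyValuation_smul_basis_eq {p q : K[X]} (h : p ≠ 0 ∨ q ≠ 0) :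
    inftyValuation W (p • (1 : W.CoordinateRing) + q • CoordinateRing.mk W X) =
      max (if p = 0 then 0 else WithZero.exp (2 * p.natDegree : ℤ))
        (if q = 0 then 0 else WithZero.exp (2 * q.natDegree + 3 : ℤ)) := by
  by_cases hp : p = 0
  · have hq : q ≠ 0 := h.resolve_left (not_not.mpr hp)
    rw [inftyValuation_smul_basis W (n := 2 * q.natDegree + 3)]
    · simp [hp, hq]
    · rw [hp, degree_eq_natDegree hq]
      simp
  by_cases hq : q = 0
  · rw [inftyValuation_smul_basis W (n := 2 * p.natDegree)]
    · simp [hp, hq]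
    · rw [hq, degree_eq_natDegree hp]
      simp
  rw [inftyValuation_smul_basis W (n := max (2 * p.natDegree) (2 * q.natDegree + 3))]
  · rw [if_neg hp, if_neg hq]
    rcases le_total (2 * p.natDegree) (2 * q.natDegree + 3) with h1 | h1
    · rw [max_eq_right h1, max_eq_right]
      · push_cast; rfl
      · rw [WithZero.exp_le_exp]; exact_mod_cast h1
    · rw [max_eq_left h1, max_eq_left]
      · push_cast; rfl
      · rw [WithZero.exp_le_exp]; exact_mod_cast h1
  · rw [degree_eq_natDegree hp, degree_eq_natDegree hq]
    norm_cast

lemma inftyPlace_val_aeval_le_iff (p q : K[X]) (n : ℤ) :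
    (inftyPlace W).val (aeval (funX W) p + aeval (funX W) q * funY W) ≤ WithZero.exp n ↔
      (p ≠ 0 → 2 * (p.natDegree : ℤ) ≤ n) ∧ (q ≠ 0 → 2 * (q.natDegree : ℤ) + 3 ≤ n) := by
  rw [← algebraMap_smul_basis, inftyPlace_val]
  by_cases h : p ≠ 0 ∨ q ≠ 0
  · rw [inftyValuation_smul_basis_eq W h, max_le_iff]
    refine and_congr ?_ ?_
    · by_cases hp : p = 0 <;> simp [hp, -WithZero.exp_add]
    · by_cases hq : q = 0 <;> simp [hq, -WithZero.exp_add]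
  · push Not at h
    simp [h]

variable {W} in
-- From `v(Y)² = v(X)³` the values of `X` and `Y` are `exp (2e)` and `exp (3e)`. Parity again
-- excludes cancellation in `p(X) + q(X) Y`, so `v` is the `e`-th power of the valuation at
-- infinity, and normalization gives `e = 1`.
lemma eq_inftyPlace {P : Place K W.FunctionField} (h : 1 < P.val (funX W)) :
    P = inftyPlace W := by
  have hX0 : P.val (funX W) ≠ 0 := (zero_lt_one.trans h).ne'
  have hsq := val_funY_sq_of_one_lt h
  have hY0 : P.val (funY W) ≠ 0 := fun h0 => by
    rw [h0, zero_pow two_ne_zero] at hsq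
    exact pow_ne_zero 3 hX0 hsq.symm
  obtain ⟨a, ha⟩ : ∃ a : ℤ, P.val (funX W) = WithZero.exp a := ⟨_, (WithZero.exp_log hX0).symm⟩
  obtain ⟨b, hb⟩ : ∃ b : ℤ, P.val (funY W) = WithZero.exp b := ⟨_, (WithZero.exp_log hY0).symm⟩
  rw [ha, hb, ← WithZero.exp_nsmul, ← WithZero.exp_nsmul, WithZero.exp_inj, nsmul_eq_mul,
    nsmul_eq_mul] at hsq
  push_cast at hsq
  rw [ha, ← WithZero.exp_zero, WithZero.exp_lt_exp] at h
  obtain ⟨e, rfl⟩ : ∃ e, a = 2 * e := ⟨b - a, by omega⟩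
  obtain rfl : b = 3 * e := by omega
  have hp (p : K[X]) (hp : p ≠ 0) :
      P.val (aeval (funX W) p) = WithZero.exp (e * (2 * p.natDegree)) := by
    rw [val_aeval_of_one_lt (by rwa [ha, ← WithZero.exp_zero, WithZero.exp_lt_exp]) hp, ha,
      ← WithZero.exp_nsmul, nsmul_eq_mul]
    congr 1; ring
  have hq (q : K[X]) (hq : q ≠ 0) :
      P.val (aeval (funX W) q * funY W) = WithZero.exp (e * (2 * q.natDegree + 3)) := by
    rw [map_mul, hp q hq, hb, ← WithZero.exp_add]
    congr 1; ring
  have key (r : W.CoordinateRing) (hr : r ≠ 0) :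
      ∃ n : ℤ, P.val (algebraMap W.CoordinateRing W.FunctionField r) = WithZero.exp (e * n) ∧
        inftyValuation W r = WithZero.exp n := by
    obtain ⟨p, q, rfl⟩ := CoordinateRing.exists_smul_basis_eq r
    rw [algebraMap_smul_basis]
    by_cases hp0 : p = 0
    · have hq0 : q ≠ 0 := by rintro rfl; simp [hp0] at hr
      refine ⟨2 * q.natDegree + 3, ?_, ?_⟩
      · rw [hp0, map_zero, zero_add, hq q hq0]
      · rw [inftyValuation_smul_basis_eq W (Or.inr hq0), if_pos hp0, if_neg hq0]
        exact max_eq_right zero_le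
    by_cases hq0 : q = 0
    · refine ⟨2 * p.natDegree, ?_, ?_⟩
      · rw [hq0, map_zero, zero_mul, add_zero, hp p hp0]
      · rw [inftyValuation_smul_basis_eq W (Or.inl hp0), if_pos hq0, if_neg hp0]
        exact max_eq_left zero_le
    rw [inftyValuation_smul_basis_eq W (Or.inl hp0), if_neg hp0, if_neg hq0]
    rcases lt_or_gt_of_ne (show 2 * p.natDegree ≠ 2 * q.natDegree + 3 by omega) with h1 | h1
    · have h1' : (2 * p.natDegree : ℤ) < 2 * q.natDegree + 3 := by exact_mod_cast h1
      refine ⟨2 * q.natDegree + 3, ?_, max_eq_right (WithZero.exp_le_exp.mpr h1'.le)⟩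
      rw [Valuation.map_add_eq_of_lt_right, hq q hq0]
      rw [hp p hp0, hq q hq0, WithZero.exp_lt_exp]
      exact mul_lt_mul_of_pos_left h1' (by omega)
    · have h1' : (2 * q.natDegree + 3 : ℤ) < 2 * p.natDegree := by exact_mod_cast h1
      refine ⟨2 * p.natDegree, ?_, max_eq_left (WithZero.exp_le_exp.mpr h1'.le)⟩
      rw [Valuation.map_add_eq_of_lt_left, hp p hp0]
      rw [hp p hp0, hq q hq0, WithZero.exp_lt_exp]
      exact mul_lt_mul_of_pos_left h1' (by omega)
  have he := Place.eq_one_of_val_eq_exp W.CoordinateRing P (e := e) (by omega)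
    (fun r => WithZero.log (inftyValuation W r)) (fun r hr => by
      obtain ⟨n, h1, h2⟩ := key r hr
      rw [h1, h2, WithZero.log_exp])
  refine Place.ext_of_algebraMap W.CoordinateRing fun r => ?_
  by_cases hr : r = 0
  · simp [hr]
  obtain ⟨n, h1, h2⟩ := key r hr
  rw [h1, inftyPlace_val, h2, he, one_mul]

variable {W} in
lemma val_funX_le_one {P : Place K W.FunctionField} (h : P ≠ inftyPlace W) :
    P.val (funX W) ≤ 1 :=
  not_lt.mp fun h1 => h (eq_inftyPlace h1)

variable {W} in
lemma ne_inftyPlace {P : Place K W.FunctionField} (h : P.val (funX W) ≤ 1) :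
    P ≠ inftyPlace W := by
  rintro rfl
  rw [inftyPlace_val_funX, ← WithZero.exp_zero, WithZero.exp_le_exp] at h
  exact absurd h (by norm_num)

/-- Here `m` is `X^i` or `X^i Y`, of pole order exactly `n`, and subtracting the leading term lowers
the pole order. The number 1 is the only natural number not of the form `2i` or `2i + 3`. -/
lemma exists_sub_lt (n : ℕ) (hn : n ≠ 1) : ∃ m : W.FunctionField,
    ∀ r : W.CoordinateRing, (inftyPlace W).val (algebraMap _ W.FunctionField r) ≤
      WithZero.exp (n : ℤ) → ∃ a : K, (inftyPlace W).val
        (algebraMap _ W.FunctionField r - algebraMap K _ a * m) < WithZero.exp (n : ℤ) := by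
  have hlt (z : ℤᵐ⁰) : z < WithZero.exp (n : ℤ) ↔ z ≤ WithZero.exp (n - 1 : ℤ) := by
    induction z using WithZero.expRecOn with
    | zero => simp [-WithZero.exp_sub]
    | exp k => rw [WithZero.exp_lt_exp, WithZero.exp_le_exp]; omega
  have hdeg (p : K[X]) (i : ℕ) (h : p ≠ 0 → p.natDegree ≤ i)
      (h1 : p - C (p.coeff i) * X ^ i ≠ 0) : (p - C (p.coeff i) * X ^ i).natDegree < i := by
    have hp : p ≠ 0 := by rintro rfl; simp at h1
    refine lt_of_le_of_ne ((natDegree_sub_le_of_le (h hp)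
      (natDegree_C_mul_X_pow_le _ _)).trans_eq (max_self i)) ?_
    intro h2
    have h3 := leadingCoeff_ne_zero.mpr h1
    rw [leadingCoeff, h2] at h3
    simp at h3
  obtain ⟨i, rfl | rfl⟩ : ∃ i, n = 2 * i ∨ n = 2 * i + 3 := by
    rcases Nat.even_or_odd' n with ⟨k, rfl | rfl⟩
    · exact ⟨k, Or.inl rfl⟩
    · exact ⟨k - 1, Or.inr (by omega)⟩
  · refine ⟨funX W ^ i, fun r hr => ?_⟩
    obtain ⟨p, q, h⟩ := exists_aeval_eq W r
    rw [h, inftyPlace_val_aeval_le_iff] at hr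
    refine ⟨p.coeff i, ?_⟩
    have e : algebraMap _ W.FunctionField r - algebraMap K _ (p.coeff i) * funX W ^ i =
        aeval (funX W) (p - C (p.coeff i) * X ^ i) + aeval (funX W) q * funY W := by
      simp [h]; ring
    rw [hlt, e, inftyPlace_val_aeval_le_iff]
    refine ⟨fun h1 => ?_, fun hq => ?_⟩
    · have := hdeg p i (fun hp => by have := hr.1 hp; push_cast at this; omega) h1
      push_cast; omega
    · have := hr.2 hq
      push_cast at this ⊢; omega
  · refine ⟨funX W ^ i * funY W, fun r hr => ?_⟩
    obtain ⟨p, q, h⟩ := exists_aeval_eq W r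
    rw [h, inftyPlace_val_aeval_le_iff] at hr
    refine ⟨q.coeff i, ?_⟩
    have e : algebraMap _ W.FunctionField r - algebraMap K _ (q.coeff i) * (funX W ^ i * funY W) =
        aeval (funX W) p + aeval (funX W) (q - C (q.coeff i) * X ^ i) * funY W := by
      simp [h]; ring
    rw [hlt, e, inftyPlace_val_aeval_le_iff]
    refine ⟨fun hp => ?_, fun h1 => ?_⟩
    · have := hr.1 hp
      push_cast at this ⊢; omega
    · have := hdeg q i (fun hq => by have := hr.2 hq; push_cast at this; omega) h1
      push_cast; omega

/-- Let `f = g/h` have no pole. Modulo lower pole order `g` and `h` are multiples `a m` and `b m` of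
one monomial, with `b ≠ 0`, so `f` takes the value `a/b`. The excluded pole order 1 does not occur,
since no norm has degree 1. -/
lemma isRational_inftyPlace : (inftyPlace W).IsRational := by
  intro f hf
  obtain ⟨g, h, hh, rfl⟩ := IsFractionRing.div_surjective (A := W.CoordinateRing) f
  have hh0 : h ≠ 0 := nonZeroDivisors.ne_zero hh
  have hv := inftyValuation_apply W hh0
  rw [← inftyPlace_val] at hv
  have hpos : 0 < (inftyPlace W).val (algebraMap _ W.FunctionField h) := by
    rw [hv]; exact WithZero.exp_pos
  have hF : algebraMap _ W.FunctionField h ≠ 0 := (Valuation.ne_zero_iff _).mp hpos.ne'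
  obtain ⟨m, hm⟩ := exists_sub_lt W _ (CoordinateRing.natDegree_norm_ne_one h)
  rw [← hv] at hm
  rw [map_div₀, div_le_one₀ hpos] at hf
  obtain ⟨a, ha⟩ := hm g hf
  obtain ⟨b, hb⟩ := hm h le_rfl
  have hb0 : b ≠ 0 := by
    rintro rfl
    simp at hb
  refine ⟨a / b, ?_⟩
  have hbF : algebraMap K W.FunctionField b ≠ 0 := by simpa using hb0
  have e : algebraMap _ W.FunctionField g / algebraMap _ W.FunctionField h -
      algebraMap K _ (a / b) = ((algebraMap _ W.FunctionField g - algebraMap K _ a * m) -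
        algebraMap K _ (a / b) * (algebraMap _ W.FunctionField h - algebraMap K _ b * m)) /
        algebraMap _ W.FunctionField h := by
    rw [map_div₀]
    field_simp
    ring
  rw [e, map_div₀, div_lt_one₀ hpos]
  refine (Valuation.map_sub _ _ _).trans_lt (max_lt ha ?_)
  rw [map_mul]
  exact (mul_le_of_le_one_left' (Place.val_algebraMap_le_one _ _)).trans_lt hb

end Places

end EllipticPlaces

namespace EllipticPlaces

open Polynomial WeierstrassCurve.Affine AlgFunField

/-! ### The places of affine points -/

section AffinePlaces

variable {K : Type*} [Field K] {W : WeierstrassCurve.Affine K}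

lemma algebraMap_XClass (x : K) :
    algebraMap W.CoordinateRing W.FunctionField (CoordinateRing.XClass W x) =
      funX W - algebraMap K _ x := by
  rw [CoordinateRing.XClass, C_sub, map_sub, map_sub,
    IsScalarTower.algebraMap_apply K W.CoordinateRing W.FunctionField]
  rfl

lemma algebraMap_YClass (y : K) :
    algebraMap W.CoordinateRing W.FunctionField (CoordinateRing.YClass W (C y)) =
      funY W - algebraMap K _ y := by
  rw [CoordinateRing.YClass, map_sub, map_sub,
    IsScalarTower.algebraMap_apply K W.CoordinateRing W.FunctionField]
  rfl

/-- In a discrete valuation ring, the valuation detects divisibility. -/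
lemma dvd_of_intValuation_le {A : Type*} [CommRing A] [IsDomain A] [IsDiscreteValuationRing A]
    {a b : A} (ha : a ≠ 0) (h : (IsDiscreteValuationRing.maximalIdeal A).intValuation a ≤
      (IsDiscreteValuationRing.maximalIdeal A).intValuation b) : b ∣ a := by
  rcases ValuationRing.dvd_total a b with ⟨c, rfl⟩ | h'
  · have ha0 := (IsDiscreteValuationRing.maximalIdeal A).intValuation_ne_zero a ha
    rw [map_mul, le_mul_iff_one_le_right (zero_lt_iff.mpr ha0)] at h
    have hc : IsUnit c := by
      by_contra hc
      exact absurd (((IsDiscreteValuationRing.maximalIdeal A).intValuation_lt_one_iff_mem c).mpr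
        ((IsLocalRing.mem_maximalIdeal c).mpr hc)) h.not_gt
    exact (associated_mul_unit_right a c hc).symm.dvd
  · exact h'

/-- The quotient `a/b` lies in the local ring of the point, so it is a fraction `w/s` whose
denominator does not vanish there. -/
lemma exists_mul_eq_mul_of_affineValuation_le {x y : K} (h : W.Nonsingular x y)
    {a b : W.CoordinateRing} (hab : affineValuation h a ≤ affineValuation h b) :
    ∃ s ∉ CoordinateRing.XYIdeal W x (C y), ∃ w, s * a = b * w := by
  by_cases ha : a = 0
  · exact ⟨1, (Ideal.ne_top_iff_one _).mp (isMaximal_XYIdeal h).ne_top, 0, by simp [ha]⟩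
  have := (isMaximal_XYIdeal h).isPrime
  have := isDiscreteValuationRing_localization h
  set M := CoordinateRing.XYIdeal W x (C y)
  have ha' : algebraMap W.CoordinateRing (Localization.AtPrime M) a ≠ 0 := by
    rwa [Ne, IsLocalization.to_map_eq_zero_iff _ M.primeCompl_le_nonZeroDivisors]
  obtain ⟨c, hc⟩ := dvd_of_intValuation_le ha' hab
  obtain ⟨⟨w, s⟩, hws⟩ := IsLocalization.surj M.primeCompl c
  refine ⟨s, s.2, w, IsLocalization.injective (Localization.AtPrime M)
    M.primeCompl_le_nonZeroDivisors ?_⟩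
  rw [map_mul, map_mul, ← hws, hc]
  ring

lemma exists_sub_mem_XYIdeal {x y : K} (h : W.Nonsingular x y) (r : W.CoordinateRing) :
    ∃ a : K, r - algebraMap K W.CoordinateRing a ∈ CoordinateRing.XYIdeal W x (C y) := by
  set e := CoordinateRing.quotientXYIdealEquiv (W' := W) (x := x) (y := C y) h.left
  refine ⟨e (Ideal.Quotient.mk _ r), ?_⟩
  rw [← Ideal.Quotient.eq]
  apply e.injective
  rw [← Ideal.Quotient.algebraMap_eq, ← IsScalarTower.algebraMap_apply K W.CoordinateRing,
    AlgEquiv.commutes]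
  rfl

lemma affinePlace_val_eq_one {x y : K} (h : W.Nonsingular x y) {r : W.CoordinateRing}
    (hr : r ∉ CoordinateRing.XYIdeal W x (C y)) :
    (affinePlace h).val (algebraMap _ W.FunctionField r) = 1 := by
  rw [affinePlace_val, affineValuation_eq_one h hr]

lemma isRational_affinePlace {x y : K} (h : W.Nonsingular x y) : (affinePlace h).IsRational := by
  intro f hf
  obtain ⟨a, b, hb, rfl⟩ := IsFractionRing.div_surjective (A := W.CoordinateRing) f
  have hb0 : b ≠ 0 := nonZeroDivisors.ne_zero hb
  have hbF : algebraMap _ W.FunctionField b ≠ 0 :=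
    (map_ne_zero_iff _ (IsFractionRing.injective _ _)).mpr hb0
  rw [map_div₀, div_le_one₀ (zero_lt_iff.mpr ((Valuation.ne_zero_iff _).mpr hbF)),
    affinePlace_val, affinePlace_val] at hf
  obtain ⟨s, hs, w, hsw⟩ := exists_mul_eq_mul_of_affineValuation_le h hf
  obtain ⟨α, hα⟩ := exists_sub_mem_XYIdeal h w
  obtain ⟨β, hβ⟩ := exists_sub_mem_XYIdeal h s
  have hβ0 : β ≠ 0 := by
    rintro rfl
    exact hs (by simpa using hβ)
  have hβF : algebraMap K W.FunctionField β ≠ 0 := by simpa using hβ0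
  have hs1 := affinePlace_val_eq_one h hs
  have hsF : algebraMap _ W.FunctionField s ≠ 0 := by
    intro h0
    simp [h0] at hs1
  refine ⟨α / β, ?_⟩
  have hsw' := congrArg (algebraMap _ W.FunctionField) hsw
  rw [map_mul, map_mul] at hsw'
  have e : algebraMap _ W.FunctionField a / algebraMap _ W.FunctionField b -
      algebraMap K _ (α / β) = (algebraMap _ W.FunctionField (w - algebraMap K _ α) -
        algebraMap K _ (α / β) * algebraMap _ W.FunctionField (s - algebraMap K _ β)) /
        algebraMap _ W.FunctionField s := by
    rw [map_div₀, map_sub, map_sub, ← IsScalarTower.algebraMap_apply,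
      ← IsScalarTower.algebraMap_apply]
    field_simp
    linear_combination algebraMap K W.FunctionField β * hsw'
  rw [e, map_div₀, hs1, div_one]
  refine (Valuation.map_sub _ _ _).trans_lt (max_lt ?_ ?_)
  · rw [affinePlace_val]
    exact (affineValuation_lt_one_iff h).mpr hα
  · rw [map_mul, affinePlace_val]
    exact (mul_le_of_le_one_left' (Place.val_algebraMap_le_one _ _)).trans_lt
      ((affineValuation_lt_one_iff h).mpr hβ)

lemma affinePlace_val_funX_sub_lt {x y : K} (h : W.Nonsingular x y) :
    (affinePlace h).val (funX W - algebraMap K _ x) < 1 := by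
  rw [← algebraMap_XClass, affinePlace_val]
  exact (affineValuation_lt_one_iff h).mpr (Ideal.subset_span (by simp))

lemma affinePlace_val_funY_sub_lt {x y : K} (h : W.Nonsingular x y) :
    (affinePlace h).val (funY W - algebraMap K _ y) < 1 := by
  rw [← algebraMap_YClass, affinePlace_val]
  exact (affineValuation_lt_one_iff h).mpr (Ideal.subset_span (by simp))

lemma val_le_one_of_sub_lt {F : Type*} [Field F] [Algebra K F] {P : Place K F} {f : F} {a : K}
    (h : P.val (f - algebraMap K F a) < 1) : P.val f ≤ 1 := by
  rw [← sub_add_cancel f (algebraMap K F a)]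
  exact (P.val.map_add _ _).trans (max_le h.le (P.val_algebraMap_le_one a))

lemma eq_of_sub_lt {F : Type*} [Field F] [Algebra K F] {P : Place K F} {f : F} {a b : K}
    (h : P.val (f - algebraMap K F a) < 1) (h' : P.val (f - algebraMap K F b) < 1) : a = b :=
  (Place.eval_eq_of_lt h).symm.trans (Place.eval_eq_of_lt h')

/-- A place at which `X - x` and `Y - y` vanish is the place of the point `(x, y)`. -/
lemma eq_affinePlace {x y : K} (h : W.Nonsingular x y) {P : Place K W.FunctionField}
    (hx : P.val (funX W - algebraMap K _ x) < 1) (hy : P.val (funY W - algebraMap K _ y) < 1) :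
    P = affinePlace h := by
  have hX := val_le_one_of_sub_lt hx
  have hlt {r : W.CoordinateRing} (hr : r ∈ CoordinateRing.XYIdeal W x (C y)) :
      P.val (algebraMap _ W.FunctionField r) < 1 := by
    obtain ⟨a, b, rfl⟩ := Ideal.mem_span_pair.mp hr
    rw [map_add, map_mul, map_mul, algebraMap_XClass, algebraMap_YClass]
    refine (P.val.map_add _ _).trans_lt (max_lt ?_ ?_)
    · rw [map_mul]
      exact (mul_le_of_le_one_left' (val_algebraMap_le_one hX _)).trans_lt hx
    · rw [map_mul]
      exact (mul_le_of_le_one_left' (val_algebraMap_le_one hX _)).trans_lt hy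
  -- Outside the ideal of the point, `r` differs from a nonzero constant by an element of the ideal.
  have hone {r : W.CoordinateRing} (hr : r ∉ CoordinateRing.XYIdeal W x (C y)) :
      P.val (algebraMap _ W.FunctionField r) = 1 := by
    refine le_antisymm (val_algebraMap_le_one hX r) (not_lt.mp fun h1 => ?_)
    obtain ⟨a, ha⟩ := exists_sub_mem_XYIdeal h r
    have h2 := hlt ha
    rw [map_sub, ← IsScalarTower.algebraMap_apply] at h2
    have ha0 := eq_of_sub_lt (b := 0) h2 (by simpa using h1)
    rw [ha0, map_zero, sub_zero] at ha
    exact hr ha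
  have hle {a b : W.CoordinateRing} (hab : affineValuation h a ≤ affineValuation h b) :
      P.val (algebraMap _ W.FunctionField a) ≤ P.val (algebraMap _ W.FunctionField b) := by
    obtain ⟨s, hs, w, hsw⟩ := exists_mul_eq_mul_of_affineValuation_le h hab
    have h1 := congrArg (fun r => P.val (algebraMap _ W.FunctionField r)) hsw
    simp only [map_mul, hone hs, one_mul] at h1
    rw [h1]
    exact mul_le_of_le_one_right' (val_algebraMap_le_one hX _)
  -- Each nonzero `r` has the affine valuation of a power of the uniformizer `t`, and by `hle` the
  -- same value at `P` as that power. So `P.val` is the `k`-th power of the affine valuation, and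
  -- normalization gives `k = 1`.
  obtain ⟨t, ht⟩ := exists_affineValuation_eq h
  have ht0 : t ≠ 0 := by
    rintro rfl
    rw [map_zero] at ht
    exact WithZero.exp_ne_zero ht.symm
  have htF : P.val (algebraMap _ W.FunctionField t) ≠ 0 := (Valuation.ne_zero_iff _).mpr
    ((map_ne_zero_iff _ (IsFractionRing.injective _ _)).mpr ht0)
  obtain ⟨k, hk⟩ : ∃ k : ℤ, P.val (algebraMap _ W.FunctionField t) = WithZero.exp (-k) :=
    ⟨-WithZero.log (P.val (algebraMap _ W.FunctionField t)), by
      rw [neg_neg, WithZero.exp_log htF]⟩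
  have hk0 : 0 ≤ k := by
    have h1 := val_algebraMap_le_one hX t
    rw [hk, ← WithZero.exp_zero, WithZero.exp_le_exp] at h1
    omega
  have key (r : W.CoordinateRing) (hr : r ≠ 0) : ∃ n : ℤ, affineValuation h r = WithZero.exp n ∧
      P.val (algebraMap _ W.FunctionField r) = WithZero.exp (k * n) := by
    obtain ⟨n, hn⟩ : ∃ n : ℤ, affineValuation h r = WithZero.exp n :=
      ⟨_, (WithZero.exp_log (affineValuation_ne_zero h hr)).symm⟩
    have hn0 : n ≤ 0 := by
      have h1 : affineValuation h r ≤ 1 := by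
        by_cases hr : r ∈ CoordinateRing.XYIdeal W x (C y)
        · exact ((affineValuation_lt_one_iff h).mpr hr).le
        · exact (affineValuation_eq_one h hr).le
      rwa [hn, ← WithZero.exp_zero, WithZero.exp_le_exp] at h1
    refine ⟨n, hn, ?_⟩
    obtain ⟨m, rfl⟩ : ∃ m : ℕ, n = -(m : ℤ) := ⟨n.natAbs, by omega⟩
    have htm : affineValuation h (t ^ m) = affineValuation h r := by
      rw [map_pow, ht, hn, ← WithZero.exp_nsmul, nsmul_eq_mul]
      congr 1; ring
    rw [le_antisymm (hle htm.ge) (hle htm.le), map_pow, map_pow, hk, ← WithZero.exp_nsmul,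
      nsmul_eq_mul]
    congr 1; ring
  have hk1 := Place.eq_one_of_val_eq_exp W.CoordinateRing P hk0
    (fun r => WithZero.log (affineValuation h r)) (fun r hr => by
      obtain ⟨n, h1, h2⟩ := key r hr
      rw [h1, h2, WithZero.log_exp])
  refine Place.ext_of_algebraMap W.CoordinateRing fun r => ?_
  by_cases hr : r = 0
  · simp [hr]
  obtain ⟨n, h1, h2⟩ := key r hr
  rw [h2, affinePlace_val, h1, hk1, one_mul]

lemma affinePlace_ne_inftyPlace {x y : K} (h : W.Nonsingular x y) :
    affinePlace h ≠ inftyPlace W :=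
  ne_inftyPlace (val_le_one_of_sub_lt (affinePlace_val_funX_sub_lt h))

lemma affinePlace_inj {x y x' y' : K} (h : W.Nonsingular x y) (h' : W.Nonsingular x' y')
    (e : affinePlace h = affinePlace h') : x = x' ∧ y = y' :=
  ⟨eq_of_sub_lt (affinePlace_val_funX_sub_lt h) (e ▸ affinePlace_val_funX_sub_lt h'),
    eq_of_sub_lt (affinePlace_val_funY_sub_lt h) (e ▸ affinePlace_val_funY_sub_lt h')⟩

/-- On an elliptic curve, the rational places are those of the rational points. -/
lemma _root_.AlgFunField.Place.IsRational.exists_affinePlace [W.IsElliptic]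
    {P : Place K W.FunctionField} (hP : P.IsRational) (hP' : P ≠ inftyPlace W) :
    ∃ (x y : K) (h : W.Nonsingular x y), P = affinePlace h := by
  have hX := val_funX_le_one hP'
  obtain ⟨x, hx⟩ := hP _ hX
  obtain ⟨y, hy⟩ := hP _ (val_funY_le_one hX)
  have hxy : W.Equation x y := by
    rw [WeierstrassCurve.Affine.equation_iff']
    set d := y ^ 2 + W.a₁ * x * y + W.a₃ * y - (x ^ 3 + W.a₂ * x ^ 2 + W.a₄ * x + W.a₆) with hd
    set ι := algebraMap K W.FunctionField
    refine (eq_of_sub_lt (P := P) (f := 0) (a := 0) (b := d) (by simp) ?_).symm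
    -- This is `F(X, Y) - F(x, y)`, sorted into multiples of `Y - y` and `X - x`. It shows that the
    -- constant `d` vanishes at `P`, so it is zero.
    have e : 0 - ι d = (funY W - ι y) * (funY W + ι (y + W.a₁ * x + W.a₃)) +
        (funX W - ι x) * (ι W.a₁ * funY W -
          (funX W ^ 2 + funX W * ι x + ι x ^ 2 + ι W.a₂ * (funX W + ι x) + ι W.a₄)) := by
      simp only [hd, map_add, map_mul, map_sub, map_pow]
      linear_combination -equation_fun W
    have hι (a : K) : ι a ∈ P.val.integer := P.val_algebraMap_le_one a
    have hXm : funX W ∈ P.val.integer := hX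
    have hYm : funY W ∈ P.val.integer := val_funY_le_one hX
    rw [e]
    refine (P.val.map_add _ _).trans_lt (max_lt ?_ ?_)
    · rw [map_mul]
      exact (mul_le_of_le_one_right' (add_mem hYm (hι _) :)).trans_lt hy
    · rw [map_mul]
      refine (mul_le_of_le_one_right' (?_ : _ ∈ P.val.integer)).trans_lt hx
      exact sub_mem (mul_mem (hι _) hYm) (add_mem (add_mem (add_mem (add_mem (pow_mem hXm 2)
        (mul_mem hXm (hι _))) (pow_mem (hι _) 2)) (mul_mem (hι _) (add_mem hXm (hι _)))) (hι _))
  exact ⟨x, y, WeierstrassCurve.Affine.equation_iff_nonsingular.mp hxy, eq_affinePlace _ hx hy⟩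

/-- The product of `Y - y` with its conjugate is a multiple of `X - x`. -/
lemma funY_sub_mul_funY_sub {x y : K} (h : W.Equation x y) :
    (funY W - algebraMap K _ y) * (funY W - algebraMap K _ (W.negY x y)) =
      (funX W - algebraMap K _ x) * (funX W ^ 2 + funX W * algebraMap K _ x +
        algebraMap K _ x ^ 2 + algebraMap K _ W.a₂ * (funX W + algebraMap K _ x) +
        algebraMap K _ W.a₄ - algebraMap K _ W.a₁ * funY W) := by
  have h' := congrArg (algebraMap K W.FunctionField)
    ((WeierstrassCurve.Affine.equation_iff _ _).mp h)
  simp only [map_add, map_mul, map_pow] at h'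
  simp only [WeierstrassCurve.Affine.negY, map_sub, map_mul, map_neg]
  linear_combination equation_fun W - h'

/-- The ideals of `P` and `-P` have product `(X - x)`. As `P ≠ -P`, the function `Y - y(-P)` in the
second ideal is a unit at `P`. Multiplying it by a uniformizer `t` gives a multiple of `X - x`, so
`X - x` vanishes to order at most one. -/
lemma affinePlace_val_funX_sub {x y : K} (h : W.Nonsingular x y) (hy : y ≠ W.negY x y) :
    (affinePlace h).val (funX W - algebraMap K _ x) = WithZero.exp (-1) := by
  have hlt := affinePlace_val_funX_sub_lt h
  refine le_antisymm ?_ ?_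
  · generalize (affinePlace h).val (funX W - algebraMap K _ x) = z at hlt
    induction z using WithZero.expRecOn with
    | zero => exact zero_le
    | exp n =>
      rw [← WithZero.exp_zero, WithZero.exp_lt_exp] at hlt
      rw [WithZero.exp_le_exp]
      omega
  · obtain ⟨t, ht⟩ := exists_affineValuation_eq h
    have htM : t ∈ CoordinateRing.XYIdeal W x (C y) := (affineValuation_lt_one_iff h).mp (by
      rw [ht, ← WithZero.exp_zero, WithZero.exp_lt_exp]; norm_num)
    have hu : CoordinateRing.YClass W (C (W.negY x y)) ∉ CoordinateRing.XYIdeal W x (C y) := by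
      intro hmem
      rw [← affineValuation_lt_one_iff h, ← affinePlace_val, algebraMap_YClass] at hmem
      exact hy (eq_of_sub_lt (affinePlace_val_funY_sub_lt h) hmem)
    have hmul : CoordinateRing.YClass W (C (W.negY x y)) * t ∈ CoordinateRing.XIdeal W x := by
      rw [← CoordinateRing.XYIdeal_neg_mul h]
      exact Ideal.mul_mem_mul (Ideal.subset_span (by simp)) htM
    obtain ⟨r, hr⟩ := Ideal.mem_span_singleton'.mp hmul
    have h1 := congrArg (fun r => (affinePlace h).val (algebraMap _ W.FunctionField r)) hr
    simp only [map_mul, affinePlace_val_eq_one h hu, one_mul] at h1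
    rw [affinePlace_val h t, ht, algebraMap_XClass] at h1
    rw [← h1]
    exact mul_le_of_le_one_left' (val_algebraMap_le_one (val_le_one_of_sub_lt hlt) r)

/-- The divisor of `X - x` is `P + (-P) - 2 P_∞`, where `P = (x, y)` is not a `2`-torsion point. -/
lemma ord_funX_sub {x y : K} (h : W.Nonsingular x y) (hy : y ≠ W.negY x y)
    (P : Place K W.FunctionField) :
    P.ord (funX W - algebraMap K _ x) =
      (Finsupp.single (affinePlace h) 1 +
        Finsupp.single (affinePlace ((WeierstrassCurve.Affine.nonsingular_neg x y).mpr h)) 1 -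
        2 • Finsupp.single (inftyPlace W) 1 : Divisor K W.FunctionField) P := by
  classical
  set h' := (WeierstrassCurve.Affine.nonsingular_neg x y).mpr h
  have hne := affinePlace_ne_inftyPlace h
  have hne' := affinePlace_ne_inftyPlace h'
  have hhh' : affinePlace h ≠ affinePlace h' := fun e => hy (affinePlace_inj h h' e).2
  simp only [Finsupp.sub_apply, Finsupp.add_apply, Finsupp.smul_apply, Finsupp.single_apply]
  by_cases hP : P = inftyPlace W
  · subst hP
    rw [if_neg hne, if_neg hne', if_pos rfl, Place.ord, Valuation.map_sub_eq_of_lt_left,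
      inftyPlace_val_funX]
    · rfl
    · refine (Place.val_algebraMap_le_one _ _).trans_lt ?_
      rw [inftyPlace_val_funX, ← WithZero.exp_zero, WithZero.exp_lt_exp]
      norm_num
  rw [if_neg (Ne.symm hP)]
  have hX := val_funX_le_one hP
  have hY := val_funY_le_one hX
  have hsub {f : W.FunctionField} (hf : P.val f ≤ 1) (a : K) :
      P.val (f - algebraMap K _ a) ≤ 1 :=
    (P.val.map_sub _ _).trans (max_le hf (P.val_algebraMap_le_one a))
  rcases (hsub hX x).lt_or_eq with hlt | heq
  -- Where `X - x` vanishes, so does the product of `Y - y` and its conjugate, hence one of the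
  -- factors. The place is then that of the point or of its negative.
  · have hprod : P.val (funY W - algebraMap K _ y) *
        P.val (funY W - algebraMap K _ (W.negY x y)) < 1 := by
      rw [← map_mul, funY_sub_mul_funY_sub h.left, map_mul]
      have hι (a : K) : algebraMap K W.FunctionField a ∈ P.val.integer :=
        P.val_algebraMap_le_one a
      have hXm : funX W ∈ P.val.integer := hX
      have hYm : funY W ∈ P.val.integer := hY
      refine (mul_le_of_le_one_right' (?_ : _ ∈ P.val.integer)).trans_lt hlt
      exact sub_mem (add_mem (add_mem (add_mem (add_mem (pow_mem hXm 2)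
        (mul_mem hXm (hι _))) (pow_mem (hι _) 2)) (mul_mem (hι _) (add_mem hXm (hι _)))) (hι _))
        (mul_mem (hι _) hYm)
    have hor : P.val (funY W - algebraMap K _ y) < 1 ∨
        P.val (funY W - algebraMap K _ (W.negY x y)) < 1 := by
      by_contra! hno
      exact absurd hprod (one_le_mul hno.1 hno.2).not_gt
    rcases hor with h1 | h1
    · obtain rfl := eq_affinePlace h hlt h1
      rw [if_pos rfl, if_neg (Ne.symm hhh'), Place.ord, affinePlace_val_funX_sub h hy]
      rfl
    · obtain rfl := eq_affinePlace h' hlt h1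
      rw [if_pos rfl, if_neg hhh', Place.ord, affinePlace_val_funX_sub h']
      · rfl
      · rw [WeierstrassCurve.Affine.negY_negY]
        exact hy.symm
  · rw [if_neg, if_neg, Place.ord, heq]
    · rfl
    · rintro rfl
      exact absurd heq (affinePlace_val_funX_sub_lt h').ne
    · rintro rfl
      exact absurd heq (affinePlace_val_funX_sub_lt h).ne

/-- A function without poles outside infinity lies in the coordinate ring. -/
lemma exists_algebraMap_eq [W.IsElliptic] {f : W.FunctionField}
    (hf : ∀ P : Place K W.FunctionField, P ≠ inftyPlace W → P.val f ≤ 1) :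
    ∃ r, algebraMap W.CoordinateRing W.FunctionField r = f := by
  refine IsDedekindDomain.HeightOneSpectrum.mem_integers_of_valuation_le_one _ f fun v => ?_
  have hv (a : K) (ha : a ≠ 0) : v.valuation W.FunctionField (algebraMap K _ a) = 1 := by
    rw [IsScalarTower.algebraMap_apply K W.CoordinateRing]
    refine le_antisymm (v.valuation_le_one _) (not_lt.mp fun h => ?_)
    rw [v.valuation_lt_one_iff_mem] at h
    exact v.isPrime.ne_top (Ideal.eq_top_of_isUnit_mem _ h
      ((IsUnit.mk0 a ha).map (algebraMap K W.CoordinateRing)))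
  -- Every maximal ideal of the Dedekind coordinate ring gives a place, and it is not the one at
  -- infinity because `X` is regular there.
  exact hf ⟨v.valuation W.FunctionField, hv, v.valuation_surjective W.FunctionField⟩
    (ne_inftyPlace (v.valuation_le_one _))

lemma exists_aeval_eq_of_val_le [W.IsElliptic] {f : W.FunctionField} {n : ℤ}
    (hf : ∀ P : Place K W.FunctionField, P ≠ inftyPlace W → P.val f ≤ 1)
    (hn : (inftyPlace W).val f ≤ WithZero.exp n) : ∃ p q : K[X],
      f = aeval (funX W) p + aeval (funX W) q * funY W ∧
      (p ≠ 0 → 2 * (p.natDegree : ℤ) ≤ n) ∧ (q ≠ 0 → 2 * (q.natDegree : ℤ) + 3 ≤ n) := by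
  obtain ⟨r, rfl⟩ := exists_algebraMap_eq hf
  obtain ⟨p, q, h⟩ := exists_aeval_eq W r
  exact ⟨p, q, h, (inftyPlace_val_aeval_le_iff W p q n).mp (h ▸ hn)⟩

end AffinePlaces

end EllipticPlaces

namespace EllipticPlaces

open Polynomial WeierstrassCurve.Affine AlgFunField

/-! ### Automorphisms fixing the point at infinity -/

section Automorphisms

variable {K : Type*} [Field K] {W : WeierstrassCurve.Affine K}

/-- Used to compare coefficients in identities between the images of `X` and `Y` under
automorphisms. -/
lemma coeff_eq_zero {c₀ c₁ c₂ c₃ d₀ d₁ : K}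
    (h : algebraMap K W.FunctionField c₀ + algebraMap K _ c₁ * funX W +
      algebraMap K _ c₂ * funX W ^ 2 + algebraMap K _ c₃ * funX W ^ 3 +
      (algebraMap K _ d₀ + algebraMap K _ d₁ * funX W) * funY W = 0) :
    c₀ = 0 ∧ c₁ = 0 ∧ c₂ = 0 ∧ c₃ = 0 ∧ d₀ = 0 ∧ d₁ = 0 := by
  have h' := aeval_eq_zero W (p := C c₀ + C c₁ * X + C c₂ * X ^ 2 + C c₃ * X ^ 3)
    (q := C d₀ + C d₁ * X) (by simpa using h)
  have hp (n : ℕ) := congrArg (fun p => coeff p n) h'.1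
  have hq (n : ℕ) := congrArg (fun p => coeff p n) h'.2
  simp only [coeff_add, coeff_C_mul, coeff_X_pow, coeff_X, coeff_C, coeff_zero] at hp hq
  have p0 := hp 0
  have p1 := hp 1
  have p2 := hp 2
  have p3 := hp 3
  have q0 := hq 0
  have q1 := hq 1
  norm_num at p0 p1 p2 p3 q0 q1
  exact ⟨p0, p1, p2, p3, q0, q1⟩

lemma algEquiv_eq_one {τ : W.FunctionField ≃ₐ[K] W.FunctionField} (hX : τ (funX W) = funX W)
    (hY : τ (funY W) = funY W) : τ = 1 := by
  have hR (r : W.CoordinateRing) :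
      τ (algebraMap _ W.FunctionField r) = algebraMap _ W.FunctionField r := by
    obtain ⟨p, q, h⟩ := exists_aeval_eq W r
    rw [h, map_add, map_mul, ← AlgEquiv.coe_toAlgHom, ← aeval_algHom_apply, ← aeval_algHom_apply,
      AlgEquiv.coe_toAlgHom, hX, hY]
  ext f
  obtain ⟨a, b, _, rfl⟩ := IsFractionRing.div_surjective (A := W.CoordinateRing) f
  rw [map_div₀, hR, hR]
  rfl

lemma val_apply_eq {F : Type*} [Field F] [Algebra K F] (τ : F ≃ₐ[K] F) (P : Place K F) (f : F) :
    P.val (τ f) = (τ⁻¹ • P).val f := rfl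

/-- Since `τ` fixes the place at infinity, `τ X` and `τ Y` lie in `L(2 P_∞) = ⟨1, X⟩` and `L(3 P_∞)
= ⟨1, X, Y⟩`. -/
lemma exists_apply_eq [W.IsElliptic] {τ : W.FunctionField ≃ₐ[K] W.FunctionField}
    (hτ : τ • inftyPlace W = inftyPlace W) : ∃ α β γ δ ε : K,
      τ (funX W) = algebraMap K _ α * funX W + algebraMap K _ β ∧
      τ (funY W) = algebraMap K _ γ * funY W + algebraMap K _ δ * funX W + algebraMap K _ ε := by
  have hne (P : Place K W.FunctionField) (hP : P ≠ inftyPlace W) : τ⁻¹ • P ≠ inftyPlace W := by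
    rwa [Ne, inv_smul_eq_iff, hτ]
  have hinv : τ⁻¹ • inftyPlace W = inftyPlace W := by rw [inv_smul_eq_iff, hτ]
  obtain ⟨p, q, hX, hp, hq⟩ := exists_aeval_eq_of_val_le (f := τ (funX W)) (n := 2)
    (fun P hP => by rw [val_apply_eq]; exact val_funX_le_one (hne P hP))
    (by rw [val_apply_eq, hinv, inftyPlace_val_funX])
  obtain ⟨p', q', hY, hp', hq'⟩ := exists_aeval_eq_of_val_le (f := τ (funY W)) (n := 3)
    (fun P hP => by rw [val_apply_eq]; exact val_funY_le_one (val_funX_le_one (hne P hP)))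
    (by rw [val_apply_eq, hinv, inftyPlace_val_funY])
  have hlin {p : K[X]} (h : p ≠ 0 → p.natDegree ≤ 1) : p = C (p.coeff 1) * X + C (p.coeff 0) := by
    refine eq_X_add_C_of_natDegree_le_one ?_
    by_cases h0 : p = 0
    · simp [h0]
    · exact h h0
  have hq0 : q = 0 := by
    by_contra h0
    have := hq h0
    omega
  have hqc : q' = C (q'.coeff 0) := by
    refine eq_C_of_natDegree_eq_zero ?_
    by_cases h0 : q' = 0
    · simp [h0]
    · have := hq' h0
      omega
  rw [hlin (p := p) (fun h0 => by have := hp h0; omega), hq0] at hX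
  rw [hlin (p := p') (fun h0 => by have := hp' h0; omega), hqc] at hY
  refine ⟨p.coeff 1, p.coeff 0, q'.coeff 0, p'.coeff 1, p'.coeff 0, ?_, ?_⟩
  · simpa using hX
  · rw [hY]
    simp only [map_add, map_mul, aeval_C, aeval_X]
    ring

/-- The conditions for an affine substitution to preserve the Weierstrass equation. -/
lemma coeff_relations {τ : W.FunctionField ≃ₐ[K] W.FunctionField} {α β γ δ ε : K}
    (hX : τ (funX W) = algebraMap K _ α * funX W + algebraMap K _ β)
    (hY : τ (funY W) = algebraMap K _ γ * funY W + algebraMap K _ δ * funX W +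
      algebraMap K _ ε) :
    γ ^ 2 = α ^ 3 ∧ -γ ^ 2 * W.a₁ + 2 * γ * δ + W.a₁ * γ * α = 0 ∧
    -γ ^ 2 * W.a₃ + 2 * γ * ε + W.a₁ * γ * β + W.a₃ * γ = 0 ∧
    γ ^ 2 * W.a₂ + δ ^ 2 + W.a₁ * α * δ - 3 * α ^ 2 * β - W.a₂ * α ^ 2 = 0 ∧
    γ ^ 2 * W.a₄ + 2 * δ * ε + W.a₁ * (α * ε + β * δ) + W.a₃ * δ - 3 * α * β ^ 2 -
      2 * W.a₂ * α * β - W.a₄ * α = 0 := by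
  have h := congrArg τ (equation_fun W)
  simp only [map_add, map_mul, map_pow, AlgEquiv.commutes, hX, hY] at h
  -- `τ` applied to the equation, minus `γ²` times the equation, has no `Y²` term; the remaining
  -- coefficients must vanish.
  obtain ⟨-, h1, h2, h3, h4, h5⟩ := coeff_eq_zero (W := W)
    (c₀ := γ ^ 2 * W.a₆ + ε ^ 2 + W.a₁ * β * ε + W.a₃ * ε - β ^ 3 - W.a₂ * β ^ 2 - W.a₄ * β - W.a₆)
    (c₁ := γ ^ 2 * W.a₄ + 2 * δ * ε + W.a₁ * (α * ε + β * δ) + W.a₃ * δ - 3 * α * β ^ 2 -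
      2 * W.a₂ * α * β - W.a₄ * α)
    (c₂ := γ ^ 2 * W.a₂ + δ ^ 2 + W.a₁ * α * δ - 3 * α ^ 2 * β - W.a₂ * α ^ 2)
    (c₃ := γ ^ 2 - α ^ 3)
    (d₀ := -γ ^ 2 * W.a₃ + 2 * γ * ε + W.a₁ * γ * β + W.a₃ * γ)
    (d₁ := -γ ^ 2 * W.a₁ + 2 * γ * δ + W.a₁ * γ * α) (by
      simp only [map_add, map_sub, map_mul, map_pow, map_neg, map_ofNat]
      linear_combination h - algebraMap K _ γ ^ 2 * equation_fun W)
  exact ⟨sub_eq_zero.mp h3, h5, h4, h2, h1⟩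

/-- `τ Y` is a root of the quadratic equation of `Y` over `K(X)`, and the root `Y` itself would give
`τ = 1`. -/
lemma apply_funY_of_apply_funX {τ : W.FunctionField ≃ₐ[K] W.FunctionField} (hτ : τ ≠ 1)
    (hX : τ (funX W) = funX W) :
    τ (funY W) = -funY W - algebraMap K _ W.a₁ * funX W - algebraMap K _ W.a₃ := by
  have h := congrArg τ (equation_fun W)
  simp only [map_add, map_mul, map_pow, AlgEquiv.commutes, hX] at h
  have h0 : (τ (funY W) - funY W) *
      (τ (funY W) - (-funY W - algebraMap K _ W.a₁ * funX W - algebraMap K _ W.a₃)) = 0 := by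
    linear_combination h - equation_fun W
  rcases mul_eq_zero.mp h0 with h1 | h1
  · exact absurd (algEquiv_eq_one hX (sub_eq_zero.mp h1)) hτ
  · exact sub_eq_zero.mp h1

/-- An involution that fixes the point at infinity fixes the function `X`. -/
lemma apply_funX_of_involution [W.IsElliptic] {τ : W.FunctionField ≃ₐ[K] W.FunctionField}
    (hτ : τ • inftyPlace W = inftyPlace W) (h2 : τ ^ 2 = 1) : τ (funX W) = funX W := by
  obtain ⟨α, β, γ, δ, ε, hX, hY⟩ := exists_apply_eq hτ
  have hXX : τ (τ (funX W)) = funX W := DFunLike.congr_fun (sq τ ▸ h2) (funX W)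
  have hYY : τ (τ (funY W)) = funY W := DFunLike.congr_fun (sq τ ▸ h2) (funY W)
  simp only [hX, hY, map_add, map_mul, AlgEquiv.commutes] at hXX hYY
  obtain ⟨x0, x1, -⟩ := coeff_eq_zero (W := W) (c₀ := α * β + β) (c₁ := α ^ 2 - 1) (c₂ := 0)
    (c₃ := 0) (d₀ := 0) (d₁ := 0) (by
      simp only [map_add, map_sub, map_mul, map_pow, map_zero, map_one]
      linear_combination hXX)
  obtain ⟨y0, -, -, -, y3, -⟩ := coeff_eq_zero (W := W) (c₀ := γ * ε + δ * β + ε)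
    (c₁ := γ * δ + δ * α) (c₂ := 0) (c₃ := 0) (d₀ := γ ^ 2 - 1) (d₁ := 0) (by
      simp only [map_add, map_sub, map_mul, map_pow, map_zero, map_one]
      linear_combination hYY)
  obtain ⟨r1, -, r3, r4, -⟩ := coeff_relations hX hY
  -- `α = α³ = γ² = 1`.
  have hα : α = 1 := by linear_combination r1.symm - α * x1 + y3
  subst hα
  -- Now `2β = 0`, so `β ≠ 0` forces characteristic 2. There `γ = 1` and `δ = 0`, and the `X²`
  -- relation becomes `3β = 0`.
  have hβ : β = 0 := by
    by_contra hβ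
    have h2 : (2 : K) = 0 := by
      refine (mul_eq_zero.mp (?_ : 2 * β = 0)).resolve_right hβ
      linear_combination x0
    have hγ : γ = 1 := by
      refine sub_eq_zero.mp (pow_eq_zero_iff two_ne_zero |>.mp (?_ : (γ - 1) ^ 2 = 0))
      linear_combination y3 + (1 - γ) * h2
    subst hγ
    have hδ : δ = 0 := by
      refine (mul_eq_zero.mp (?_ : δ * β = 0)).resolve_right hβ
      linear_combination y0 - ε * h2
    subst hδ
    exact hβ (by linear_combination -r4 - β * h2)
  rw [hX, hβ]
  simp

lemma smul_affinePlace_of_involution [W.IsElliptic]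
    {τ : W.FunctionField ≃ₐ[K] W.FunctionField} (hτ : τ • inftyPlace W = inftyPlace W)
    (h1 : τ ≠ 1) (h2 : τ ^ 2 = 1) {x y : K} (h : W.Nonsingular x y) :
    τ • affinePlace h =
      affinePlace ((WeierstrassCurve.Affine.nonsingular_neg x y).mpr h) := by
  have hX := apply_funX_of_involution hτ h2
  have hY := apply_funY_of_apply_funX h1 hX
  have hinv : τ.symm = τ := by
    change τ⁻¹ = τ
    rw [inv_eq_iff_mul_eq_one, ← sq, h2]
  refine eq_affinePlace _ ?_ ?_
  · rw [Place.smul_val, hinv, map_sub, AlgEquiv.commutes, hX]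
    exact affinePlace_val_funX_sub_lt h
  · have e : τ (funY W - algebraMap K _ (W.negY x y)) = -(funY W - algebraMap K _ y) -
        algebraMap K _ W.a₁ * (funX W - algebraMap K _ x) := by
      simp only [map_sub, AlgEquiv.commutes, hY, WeierstrassCurve.Affine.negY, map_mul, map_neg]
      ring
    rw [Place.smul_val, hinv, e]
    refine (Valuation.map_sub _ _ _).trans_lt (max_lt ?_ ?_)
    · rw [Valuation.map_neg]
      exact affinePlace_val_funY_sub_lt h
    · rw [map_mul]
      exact (mul_le_of_le_one_left' (Place.val_algebraMap_le_one _ _)).trans_lt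
        (affinePlace_val_funX_sub_lt h)

/-- At a fixed place, `f` and `τ f` take the same value. -/
lemma eq_of_smul_affinePlace_eq {τ : W.FunctionField ≃ₐ[K] W.FunctionField} {x y : K}
    {h : W.Nonsingular x y} (hfix : τ • affinePlace h = affinePlace h) {f : W.FunctionField}
    {a b : K} (ha : (affinePlace h).val (f - algebraMap K _ a) < 1)
    (hb : (affinePlace h).val (τ f - algebraMap K _ b) < 1) : a = b := by
  refine eq_of_sub_lt ha ?_
  rwa [← AlgEquiv.commutes τ, ← map_sub, val_apply_eq, inv_smul_eq_iff.mpr hfix.symm] at hb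

/-- The fixed points of an automorphism of order three are `3`-torsion points. -/
lemma three_nsmul_eq_zero_of_smul_affinePlace_eq [DecidableEq K] [W.IsElliptic]
    {τ : W.FunctionField ≃ₐ[K] W.FunctionField} (hτ : τ • inftyPlace W = inftyPlace W)
    (h1 : τ ≠ 1) (h3 : τ ^ 3 = 1) {x y : K} (h : W.Nonsingular x y) (hy : y ≠ W.negY x y)
    (hfix : τ • affinePlace h = affinePlace h) : 3 • Point.some x y h = 0 := by
  obtain ⟨α, β, γ, δ, ε, hX, hY⟩ := exists_apply_eq hτ
  have hvx := affinePlace_val_funX_sub_lt h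
  have hvy := affinePlace_val_funY_sub_lt h
  have hmul {f : W.FunctionField} (hf : (affinePlace h).val f < 1) (a : K) :
      (affinePlace h).val (algebraMap K _ a * f) < 1 := by
    rw [map_mul]
    exact (mul_le_of_le_one_left' (Place.val_algebraMap_le_one _ _)).trans_lt hf
  have hx' : x = α * x + β := eq_of_smul_affinePlace_eq hfix hvx (by
    rw [hX, map_add, map_mul, add_sub_add_right_eq_sub, ← mul_sub]
    exact hmul hvx α)
  have hy' : y = γ * y + δ * x + ε := eq_of_smul_affinePlace_eq hfix hvy (by
    rw [hY, map_add, map_add, map_mul, map_mul, add_sub_add_right_eq_sub, add_sub_add_comm,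
      ← mul_sub, ← mul_sub]
    exact (Valuation.map_add _ _ _).trans_lt (max_lt (hmul hvy γ) (hmul hvx δ)))
  have h3' : τ * (τ * τ) = 1 := by rw [← h3, pow_succ', sq]
  have hXX : τ (τ (τ (funX W))) = funX W := DFunLike.congr_fun h3' (funX W)
  have hYY : τ (τ (τ (funY W))) = funY W := DFunLike.congr_fun h3' (funY W)
  simp only [hX, hY, map_add, map_mul, AlgEquiv.commutes] at hXX hYY
  obtain ⟨-, hα, -⟩ := coeff_eq_zero (W := W) (c₀ := α * (α * β + β) + β) (c₁ := α ^ 3 - 1)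
    (c₂ := 0) (c₃ := 0) (d₀ := 0) (d₁ := 0) (by
      simp only [map_add, map_sub, map_mul, map_pow, map_zero, map_one]
      linear_combination hXX)
  obtain ⟨-, -, -, -, hγ, -⟩ := coeff_eq_zero (W := W)
    (c₀ := γ * (γ * ε + δ * β + ε) + δ * (α * β + β) + ε)
    (c₁ := γ * (γ * δ + δ * α) + δ * α ^ 2) (c₂ := 0) (c₃ := 0) (d₀ := γ ^ 3 - 1) (d₁ := 0) (by
      simp only [map_add, map_sub, map_mul, map_pow, map_zero, map_one]
      linear_combination hYY)
  obtain ⟨r1, r2, -, r4, r5⟩ := coeff_relations hX hY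
  obtain rfl : γ = 1 := by linear_combination hγ - γ * (r1 + hα)
  -- If `α = 1`, then `τ` fixes `X`, hence is negation, and its fixed points are 2-torsion.
  by_cases hα1 : α = 1
  · subst hα1
    obtain rfl : β = 0 := by linear_combination -hx'
    have hX' : τ (funX W) = funX W := by rw [hX]; simp
    have hY' := apply_funY_of_apply_funX h1 hX'
    refine absurd (eq_of_smul_affinePlace_eq hfix hvy (b := W.negY x y) ?_) hy
    have e : τ (funY W) - algebraMap K _ (W.negY x y) = -(funY W - algebraMap K _ y) -
        algebraMap K _ W.a₁ * (funX W - algebraMap K _ x) := by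
      simp only [hY', WeierstrassCurve.Affine.negY, map_sub, map_mul, map_neg]
      ring
    rw [e]
    refine (Valuation.map_sub _ _ _).trans_lt (max_lt ?_ (hmul hvx _))
    rwa [Valuation.map_neg]
  · obtain rfl : β = x - α * x := by linear_combination -hx'
    obtain rfl : ε = -δ * x := by linear_combination -hy'
    have hD : α - 1 ≠ 0 := sub_ne_zero.mpr hα1
    -- `m` is the slope of the `τ`-invariant line through the fixed point. The coefficient relations
    -- show that this line is the tangent there (`hslope`) and that the doubled point has the same
    -- `x`-coordinate, so the fixed point is a flex.
    obtain ⟨m, rfl⟩ : ∃ m, δ = (α - 1) * m := ⟨δ / (α - 1), by field_simp⟩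
    have ha₁ : W.a₁ = -2 * m := mul_left_cancel₀ hD (by linear_combination r2)
    -- If `α = -1`, then `α³ = 1` gives `2 = 0`, and so `α = 1`.
    have hD' : α + 1 ≠ 0 := by
      intro h0
      have hα' : α = -1 := by linear_combination h0
      refine hα1 ?_
      rw [hα'] at hα ⊢
      linear_combination hα
    have ha₂ : W.a₂ + 3 * x = -m ^ 2 := by
      refine mul_left_cancel₀ (mul_ne_zero hD hD') ?_
      rw [ha₁] at r4
      linear_combination -r4 + 3 * x * hα
    have hslope : W.slope x x y y = m := by
      rw [WeierstrassCurve.Affine.slope_of_Y_ne rfl hy, div_eq_iff (sub_ne_zero.mpr hy)]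
      refine mul_left_cancel₀ hD ?_
      simp only [WeierstrassCurve.Affine.negY]
      linear_combination 3 * x ^ 2 * hα - (y * r2 + 2 * x * r4 + r5)
    have hdouble := Point.add_self_of_Y_ne (h₁ := h) hy
    have hor := (Point.X_eq_iff (h₁ := (WeierstrassCurve.Affine.nonsingular_add h h
      fun hxy => hy hxy.2)) (h₂ := h)).mp (by
        rw [hslope, WeierstrassCurve.Affine.addX]
        linear_combination m * ha₁ - ha₂)
    rw [← hdouble] at hor
    rcases hor with h0 | h0
    · exact absurd (add_eq_left.mp h0) (Point.some_ne_zero h)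
    · rw [succ_nsmul, two_nsmul, h0, neg_add_cancel]

end Automorphisms

end EllipticPlaces

/-! ### Orders of products, and degrees of divisors. -/

namespace AlgFunField

variable {K F : Type*} [Field K] [Field F] [Algebra K F]

namespace Place

lemma ord_one (P : Place K F) : P.ord 1 = 0 := by
  rw [ord, map_one, WithZero.log_one, neg_zero]

lemma ord_mul (P : Place K F) {f g : F} (hf : f ≠ 0) (hg : g ≠ 0) :
    P.ord (f * g) = P.ord f + P.ord g := by
  rw [ord, map_mul, WithZero.log_mul (P.val.ne_zero_iff.mpr hf) (P.val.ne_zero_iff.mpr hg),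
    neg_add]
  rfl

lemma ord_zpow (P : Place K F) (f : F) (n : ℤ) : P.ord (f ^ n) = n * P.ord f := by
  rw [ord, map_zpow₀, WithZero.log_zpow, smul_eq_mul, ord, mul_neg]

lemma ord_prod (P : Place K F) {ι : Type*} (s : Finset ι) (f : ι → F) (h : ∀ i ∈ s, f i ≠ 0) :
    P.ord (∏ i ∈ s, f i) = ∑ i ∈ s, P.ord (f i) := by
  classical
  induction s using Finset.induction_on with
  | empty => simp [ord_one]
  | insert a s ha ih =>
    rw [Finset.prod_insert ha, Finset.sum_insert ha,
      P.ord_mul (h a (Finset.mem_insert_self a s))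
        (Finset.prod_ne_zero_iff.mpr fun i hi => h i (Finset.mem_insert_of_mem hi)),
      ih fun i hi => h i (Finset.mem_insert_of_mem hi)]

end Place

/-- The degree of divisors, as a homomorphism. -/
noncomputable def Divisor.degreeHom : Divisor K F →+ ℤ :=
  Finsupp.liftAddHom fun P => AddMonoidHom.mulRight (P.degree : ℤ)

lemma Divisor.degreeHom_apply (G : Divisor K F) : Divisor.degreeHom G = G.degree := rfl

lemma Divisor.degree_single (P : Place K F) (n : ℤ) :
    Divisor.degree (Finsupp.single P n) = n * P.degree :=
  Finsupp.sum_single_index (zero_mul _)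

end AlgFunField

namespace EllipticPlaces

open Polynomial WeierstrassCurve.Affine AlgFunField

/-! ### Orbits of affine points under `σ`. -/

section Orbits

variable {K : Type*} [Field K] {W : WeierstrassCurve.Affine K}

lemma funX_sub_ne_zero (x : K) : funX W - algebraMap K _ x ≠ 0 := by
  rw [← algebraMap_XClass]
  exact (map_ne_zero_iff _ (IsFractionRing.injective _ _)).mpr (CoordinateRing.XClass_ne_zero x)

lemma eval_affinePlace_funX {x y : K} (h : W.Nonsingular x y) :
    (affinePlace h).eval (funX W) = x :=
  Place.eval_eq_of_lt (affinePlace_val_funX_sub_lt h)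

lemma pow_smul_inftyPlace {σ : W.FunctionField ≃ₐ[K] W.FunctionField}
    (hσ : σ • inftyPlace W = inftyPlace W) (n : ℕ) : σ ^ n • inftyPlace W = inftyPlace W :=
  (MulAction.stabilizer _ (inftyPlace W)).pow_mem (x := σ) hσ n

lemma exists_pow_smul_eq [W.IsElliptic] {σ : W.FunctionField ≃ₐ[K] W.FunctionField}
    (hσ : σ • inftyPlace W = inftyPlace W) {x y : K} (h : W.Nonsingular x y) (n : ℕ) :
    ∃ (x' y' : K) (h' : W.Nonsingular x' y'), σ ^ n • affinePlace h = affinePlace h' := by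
  refine ((isRational_affinePlace h).smul _).exists_affinePlace fun h0 => ?_
  rw [← pow_smul_inftyPlace hσ n, smul_left_cancel_iff] at h0
  exact affinePlace_ne_inftyPlace h h0

lemma ne_negY_of_two_nsmul_ne_zero [DecidableEq K] {x y : K} {h : W.Nonsingular x y}
    (h2 : 2 • Point.some x y h ≠ 0) : y ≠ W.negY x y := fun hy =>
  h2 (by rw [two_nsmul, Point.add_self_of_Y_eq hy])

variable {σ : W.FunctionField ≃ₐ[K] W.FunctionField}

section

variable [W.IsElliptic] (hσ : σ • inftyPlace W = inftyPlace W) {k : ℕ} (hk : orderOf σ = k + k)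
  (hk0 : 0 < k)
include hσ hk hk0

lemma pow_half_smul_affinePlace {x y : K} (h : W.Nonsingular x y) :
    σ ^ k • affinePlace h =
      affinePlace ((WeierstrassCurve.Affine.nonsingular_neg x y).mpr h) := by
  refine smul_affinePlace_of_involution (pow_smul_inftyPlace hσ k)
    (pow_ne_one_of_lt_orderOf hk0.ne' (by omega)) ?_ h
  rw [← pow_mul, mul_two, ← hk, pow_orderOf_eq_one]

lemma pow_half_smul_affinePlace_ne {x y : K} (h : W.Nonsingular x y) (hy : y ≠ W.negY x y) :
    σ ^ k • affinePlace h ≠ affinePlace h := by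
  rw [pow_half_smul_affinePlace hσ hk hk0]
  exact fun e => hy (affinePlace_inj _ _ e).2.symm

end

/-- A power of `σ` fixing the point has a further power, still fixing it, equal to the involution `σ
^ (ℓ/2)` or, for `ℓ = 6`, to the element `σ²` of order three. The torsion hypotheses exclude both.
-/
lemma pow_smul_affinePlace_ne [DecidableEq K] [W.IsElliptic]
    (hσ : σ • inftyPlace W = inftyPlace W)
    (hord : orderOf σ = 2 ∨ orderOf σ = 4 ∨ orderOf σ = 6) {x y : K} {h : W.Nonsingular x y}
    (h2 : 2 • Point.some x y h ≠ 0) (h3 : 3 • Point.some x y h ≠ 0) {i : ℕ} (hi : 0 < i)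
    (hi' : i < orderOf σ) : σ ^ i • affinePlace h ≠ affinePlace h := by
  have hy := ne_negY_of_two_nsmul_ne_zero h2
  intro hfix
  have hmul (m : ℕ) : σ ^ (i * m) • affinePlace h = affinePlace h := by
    rw [pow_mul]
    exact (MulAction.stabilizer _ (affinePlace h)).pow_mem (x := σ ^ i) hfix m
  -- Reduces the exponent `i * m` modulo `ℓ`.
  have hmod (j m : ℕ) (hjm : i * m = j + orderOf σ * (i * m / orderOf σ)) :
      σ ^ j • affinePlace h = affinePlace h := by
    have h1 := hmul m
    rwa [hjm, pow_add, pow_mul, pow_orderOf_eq_one, one_pow, mul_one] at h1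
  have hhalf (k : ℕ) (hk : orderOf σ = k + k) (hk0 : 0 < k) :=
    pow_half_smul_affinePlace_ne hσ hk hk0 h hy
  rcases hord with ho | ho | ho
  · obtain rfl : i = 1 := by omega
    exact hhalf 1 ho one_pos hfix
  · refine hhalf 2 ho two_pos ?_
    obtain rfl | rfl | rfl : i = 1 ∨ i = 2 ∨ i = 3 := by omega
    · exact hmod 2 2 (by rw [ho])
    · exact hfix
    · exact hmod 2 2 (by rw [ho])
  · have h6 : σ ^ 6 = 1 := by rw [← ho, pow_orderOf_eq_one]
    have hno : σ ^ 2 • affinePlace h ≠ affinePlace h := fun hf =>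
      h3 (three_nsmul_eq_zero_of_smul_affinePlace_eq (pow_smul_inftyPlace hσ 2)
        (pow_ne_one_of_lt_orderOf two_ne_zero (by omega)) (by rw [← pow_mul, h6]) h hy hf)
    obtain rfl | rfl | rfl | rfl | rfl : i = 1 ∨ i = 2 ∨ i = 3 ∨ i = 4 ∨ i = 5 := by omega
    · exact hno (hmod 2 2 (by rw [ho]))
    · exact hno hfix
    · exact hhalf 3 ho three_pos hfix
    · exact hno (hmod 2 2 (by rw [ho]))
    · exact hno (hmod 2 4 (by rw [ho]))

lemma injOn_pow_smul_affinePlace [DecidableEq K] [W.IsElliptic]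
    (hσ : σ • inftyPlace W = inftyPlace W)
    (hord : orderOf σ = 2 ∨ orderOf σ = 4 ∨ orderOf σ = 6) {x y : K} {h : W.Nonsingular x y}
    (h2 : 2 • Point.some x y h ≠ 0) (h3 : 3 • Point.some x y h ≠ 0) :
    Set.InjOn (fun i => σ ^ i • affinePlace h) (Finset.range (orderOf σ)) := by
  have key (i j : ℕ) (hij : i < j) (hj : j < orderOf σ) :
      σ ^ i • affinePlace h ≠ σ ^ j • affinePlace h := by
    intro e
    obtain ⟨m, rfl⟩ := Nat.exists_eq_add_of_lt hij
    rw [add_assoc, pow_add, mul_smul, smul_left_cancel_iff] at e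
    exact pow_smul_affinePlace_ne hσ hord h2 h3 (Nat.succ_pos m) (by omega) e.symm
  intro i hi j hj e
  rw [Finset.mem_coe, Finset.mem_range] at hi hj
  rcases lt_trichotomy i j with hlt | heq | hlt
  · exact absurd e (key i j hlt hj)
  · exact heq
  · exact absurd e.symm (key j i hlt hi)

lemma sum_orbit [DecidableEq K] [W.IsElliptic] (hσ : σ • inftyPlace W = inftyPlace W)
    (hord : orderOf σ = 2 ∨ orderOf σ = 4 ∨ orderOf σ = 6) {x y : K} {h : W.Nonsingular x y}
    (h2 : 2 • Point.some x y h ≠ 0) (h3 : 3 • Point.some x y h ≠ 0) {M : Type*}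
    [AddCommMonoid M] (g : Place K W.FunctionField → M) :
    ∑ P ∈ Place.orbit σ (affinePlace h), g P =
      ∑ i ∈ Finset.range (orderOf σ), g (σ ^ i • affinePlace h) := by
  classical
  unfold Place.orbit
  convert Finset.sum_image (injOn_pow_smul_affinePlace hσ hord h2 h3)

/-- The divisor of `∏_ρ (X - x(σ^ρ Q))`. -/
lemma ord_prod_funX_sub [DecidableEq K] [W.IsElliptic] (hσ : σ • inftyPlace W = inftyPlace W)
    (hord : orderOf σ = 2 ∨ orderOf σ = 4 ∨ orderOf σ = 6) {x y : K} {h : W.Nonsingular x y}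
    (h2 : 2 • Point.some x y h ≠ 0) (h3 : 3 • Point.some x y h ≠ 0)
    (P : Place K W.FunctionField) :
    P.ord (∏ ρ ∈ Finset.range (orderOf σ / 2),
      (funX W - algebraMap K _ ((σ ^ ρ • affinePlace h).eval (funX W)))) =
    (∑ P' ∈ Place.orbit σ (affinePlace h), Finsupp.single P' 1 -
      orderOf σ • Finsupp.single (inftyPlace W) 1 : Divisor K W.FunctionField) P := by
  obtain ⟨k, hk, hk0⟩ : ∃ k, orderOf σ = k + k ∧ 0 < k := ⟨orderOf σ / 2, by omega, by omega⟩
  have hk2 : orderOf σ / 2 = k := by omega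
  rw [P.ord_prod _ _ fun _ _ => funX_sub_ne_zero _, sum_orbit hσ hord h2 h3, hk2, hk,
    Finset.sum_range_add, ← Finset.sum_add_distrib]
  have hrw : (k + k) • (Finsupp.single (inftyPlace W) 1 : Divisor K W.FunctionField) =
      ∑ _i ∈ Finset.range k, 2 • Finsupp.single (inftyPlace W) 1 := by
    rw [Finset.sum_const, Finset.card_range, smul_smul, mul_two]
  rw [hrw, ← Finset.sum_sub_distrib, Finsupp.finsetSum_apply]
  refine Finset.sum_congr rfl fun ρ _ => ?_
  obtain ⟨x', y', h', e⟩ := exists_pow_smul_eq hσ h ρ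
  -- If `σ^ρ Q` were 2-torsion, `σ^k` would fix it, and hence would fix `Q`, as powers of `σ`
  -- commute.
  have hy' : y' ≠ W.negY x' y' := by
    intro hy'
    refine pow_half_smul_affinePlace_ne hσ hk hk0 h (ne_negY_of_two_nsmul_ne_zero h2) ?_
    have h1 := pow_half_smul_affinePlace hσ hk hk0 h'
    have h4 : affinePlace ((WeierstrassCurve.Affine.nonsingular_neg x' y').mpr h') =
        affinePlace h' := by congr 1; exact hy'.symm
    rwa [h4, ← e, smul_smul, ← pow_add, add_comm, pow_add, mul_smul, smul_left_cancel_iff] at h1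
  -- The points with exponents `ρ` and `k + ρ` are negatives of each other, so together they form
  -- the zeros of one factor `X - x'`.
  rw [add_comm k ρ, add_comm ρ k, pow_add, mul_smul, e, eval_affinePlace_funX,
    pow_half_smul_affinePlace hσ hk hk0 h']
  exact ord_funX_sub h' hy' P

/-! ### The Riemann-Roch space and its basis. -/

/-- The Riemann-Roch space of a divisor `(h) + n P_∞`. -/
lemma mem_riemannRochSpace_iff [W.IsElliptic] {G : Divisor K W.FunctionField}
    {h : W.FunctionField} (h0 : h ≠ 0) {n : ℤ} (hG : ∀ P : Place K W.FunctionField,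
      P.ord h = (G - n • Finsupp.single (inftyPlace W) 1 : Divisor K W.FunctionField) P)
    {f : W.FunctionField} : f ∈ riemannRochSpace G ↔ ∃ p q : K[X],
      f * h = aeval (funX W) p + aeval (funX W) q * funY W ∧
      (p ≠ 0 → 2 * (p.natDegree : ℤ) ≤ n) ∧ (q ≠ 0 → 2 * (q.natDegree : ℤ) + 3 ≤ n) := by
  classical
  by_cases hf : f = 0
  · subst hf
    exact ⟨fun _ => ⟨0, 0, by simp⟩, fun _ => zero_mem _⟩
  have hfh : f * h ≠ 0 := mul_ne_zero hf h0
  -- Adding the order of `h` to both sides replaces the bound `-G` by `-n` at infinity and by `0`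
  -- elsewhere.
  have hinf : -(G (inftyPlace W)) ≤ (inftyPlace W).ord f ↔
      (inftyPlace W).val (f * h) ≤ WithZero.exp n := by
    rw [← neg_le_ord_iff hfh, Place.ord_mul _ hf h0, hG]
    simp only [Finsupp.sub_apply, Finsupp.smul_apply, Finsupp.single_eq_same, smul_eq_mul]
    constructor <;> intro <;> omega
  have hfin (P : Place K W.FunctionField) (hP : P ≠ inftyPlace W) :
      -(G P) ≤ P.ord f ↔ P.val (f * h) ≤ 1 := by
    rw [← WithZero.exp_zero, ← neg_le_ord_iff hfh, Place.ord_mul _ hf h0, hG]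
    simp only [Finsupp.sub_apply, Finsupp.smul_apply, Finsupp.single_apply, if_neg hP.symm,
      smul_zero]
    constructor <;> intro <;> omega
  have hmem : f ∈ riemannRochSpace G ↔ ∀ P : Place K W.FunctionField, -(G P) ≤ P.ord f :=
    or_iff_right hf
  rw [hmem]
  constructor
  · intro H
    exact exists_aeval_eq_of_val_le (fun P hP => (hfin P hP).mp (H P)) (hinf.mp (H _))
  · rintro ⟨p, q, e, hpq⟩ P
    by_cases hP : P = inftyPlace W
    · subst hP
      rw [hinf, e]
      exact (inftyPlace_val_aeval_le_iff W p q n).mpr hpq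
    · rw [hfin P hP, e, ← algebraMap_smul_basis]
      exact val_algebraMap_le_one (val_funX_le_one hP) _

/-- Through the tower `K ⊂ K[X]`, the products `X^i Y^j` with `j ≤ 1` form a `K`-basis of the
coordinate ring, and `r ↦ r/h` is injective. -/
lemma linearIndependent_monomials (n : ℤ) {h : W.FunctionField} (h0 : h ≠ 0) :
    LinearIndependent K (fun ij : {ij : ℕ × ℕ // ij.2 ≤ 1 ∧ 2 * (ij.1 : ℤ) + 3 * (ij.2 : ℤ) ≤ n} =>
      funX W ^ ij.1.1 * funY W ^ ij.1.2 / h) := by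
  have hb := ((Polynomial.basisMonomials K).smulTower (CoordinateRing.basis W)).linearIndependent
  let ψ : {ij : ℕ × ℕ // ij.2 ≤ 1 ∧ 2 * (ij.1 : ℤ) + 3 * (ij.2 : ℤ) ≤ n} → ℕ × Fin 2 :=
    fun ij => (ij.1.1, ⟨ij.1.2, Nat.lt_succ_of_le ij.2.1⟩)
  have hψ : Function.Injective ψ := by
    rintro ⟨⟨i, j⟩, hij⟩ ⟨⟨i', j'⟩, hij'⟩ e
    simp only [ψ, Prod.mk.injEq, Fin.mk.injEq] at e
    simp [e.1, e.2]
  let φ : W.CoordinateRing →ₗ[K] W.FunctionField :=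
    LinearMap.mulRight K h⁻¹ ∘ₗ (IsScalarTower.toAlgHom K W.CoordinateRing _).toLinearMap
  have hφ : Function.Injective φ := (mul_left_injective₀ (inv_ne_zero h0)).comp
    (IsFractionRing.injective W.CoordinateRing W.FunctionField)
  have e : (fun ij : {ij : ℕ × ℕ // ij.2 ≤ 1 ∧ 2 * (ij.1 : ℤ) + 3 * (ij.2 : ℤ) ≤ n} =>
      funX W ^ ij.1.1 * funY W ^ ij.1.2 / h) =
      φ ∘ (((Polynomial.basisMonomials K).smulTower (CoordinateRing.basis W)) ∘ ψ) := by
    funext ⟨⟨i, j⟩, hij⟩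
    have hj : j = 0 ∨ j = 1 := by have := hij.1; simp only at this; omega
    have hX : algebraMap W.CoordinateRing W.FunctionField
        ((monomial i (1 : K)) • (1 : W.CoordinateRing)) = funX W ^ i := by
      have h1 := algebraMap_smul_basis W (monomial i 1) 0
      rw [zero_smul, add_zero] at h1
      rw [h1]
      simp
    have hY : algebraMap W.CoordinateRing W.FunctionField
        ((monomial i (1 : K)) • CoordinateRing.mk W X) = funX W ^ i * funY W := by
      have h1 := algebraMap_smul_basis W 0 (monomial i 1)
      rw [zero_smul, zero_add] at h1
      rw [h1]
      simp
    rcases hj with rfl | rfl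
    · simp only [Function.comp_apply, ψ, Module.Basis.smulTower_apply, coe_basisMonomials, φ,
        LinearMap.comp_apply, LinearMap.mulRight_apply, pow_zero, mul_one, div_eq_mul_inv]
      congr 1
      rw [← hX]
      exact congrArg (fun z => algebraMap W.CoordinateRing W.FunctionField
        (monomial i (1 : K) • z)) CoordinateRing.basis_zero.symm
    · simp only [Function.comp_apply, ψ, Module.Basis.smulTower_apply, coe_basisMonomials, φ,
        LinearMap.comp_apply, LinearMap.mulRight_apply, pow_one, div_eq_mul_inv]
      congr 1
      rw [← hY]
      exact congrArg (fun z => algebraMap W.CoordinateRing W.FunctionField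
        (monomial i (1 : K) • z)) CoordinateRing.basis_one.symm
  rw [e]
  exact (hb.comp ψ hψ).map' φ (LinearMap.ker_eq_bot.mpr hφ)

lemma span_monomials_eq [W.IsElliptic] {G : Divisor K W.FunctionField} {h : W.FunctionField}
    (h0 : h ≠ 0) {n : ℤ} (hG : ∀ P : Place K W.FunctionField,
      P.ord h = (G - n • Finsupp.single (inftyPlace W) 1 : Divisor K W.FunctionField) P) :
    Submodule.span K (Set.range
      (fun ij : {ij : ℕ × ℕ // ij.2 ≤ 1 ∧ 2 * (ij.1 : ℤ) + 3 * (ij.2 : ℤ) ≤ n} =>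
        funX W ^ ij.1.1 * funY W ^ ij.1.2 / h)) = riemannRochSpace G := by
  refine le_antisymm (Submodule.span_le.mpr ?_) fun f hf => ?_
  · rintro _ ⟨⟨⟨i, j⟩, hij⟩, rfl⟩
    simp only at hij
    rw [SetLike.mem_coe, mem_riemannRochSpace_iff h0 hG]
    have hj : j = 0 ∨ j = 1 := by omega
    rcases hj with rfl | rfl
    · refine ⟨X ^ i, 0, ?_, fun _ => ?_, fun h1 => absurd rfl h1⟩
      · simp [h0]
      · rw [natDegree_X_pow]; push_cast at hij; omega
    · refine ⟨0, X ^ i, ?_, fun h1 => absurd rfl h1, fun _ => ?_⟩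
      · simp [h0]
      · rw [natDegree_X_pow]; push_cast at hij; omega
  · obtain ⟨p, q, e, hp, hq⟩ := (mem_riemannRochSpace_iff h0 hG).mp hf
    have hf' : f = aeval (funX W) p / h + aeval (funX W) q * funY W / h := by
      rw [← add_div, ← e, mul_div_assoc, div_self h0, mul_one]
    rw [hf']
    refine add_mem ?_ ?_
    · by_cases hp0 : p = 0
      · simp [hp0]
      rw [aeval_eq_sum_range, Finset.sum_div]
      refine Submodule.sum_mem _ fun i hi => ?_
      rw [smul_div_assoc]
      refine Submodule.smul_mem _ _ (Submodule.subset_span ⟨⟨(i, 0), zero_le_one, ?_⟩, ?_⟩)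
      · have := hp hp0
        have := Finset.mem_range.mp hi
        push_cast; omega
      · simp
    · by_cases hq0 : q = 0
      · simp [hq0]
      rw [aeval_eq_sum_range, Finset.sum_mul, Finset.sum_div]
      refine Submodule.sum_mem _ fun i hi => ?_
      rw [smul_mul_assoc, smul_div_assoc]
      refine Submodule.smul_mem _ _ (Submodule.subset_span ⟨⟨(i, 1), le_rfl, ?_⟩, ?_⟩)
      · have := hq hq0
        have := Finset.mem_range.mp hi
        push_cast; omega
      · simp

end Orbits

end EllipticPlaces

/-! ### The theorem. -/

theorem mainTheorem4 {K : Type*} [Field K] [Finite K] [DecidableEq K]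
    (W : WeierstrassCurve.Affine K) [W.IsElliptic]
    (σ : W.FunctionField ≃ₐ[K] W.FunctionField)
    (hσ : σ • EllipticPlaces.inftyPlace W = EllipticPlaces.inftyPlace W)
    (ℓ : ℕ) (hℓ : orderOf σ = ℓ) (hℓ' : ℓ = 2 ∨ ℓ = 4 ∨ ℓ = 6)
    (s : ℕ) (Q : Fin s → W.Point) (hQ2 : ∀ z, 2 • Q z ≠ 0) (hQ3 : ∀ z, 3 • Q z ≠ 0)
    (t : Fin s → ℤ) (c : ℤ) (hc : c ≤ ℓ * ∑ z, t z) :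
    (EllipticPlaces.orbitDivisor W σ Q t c).degree = ℓ * (∑ z, t z) - c ∧
    ∃ b : Module.Basis
        {ij : ℕ × ℕ // ij.2 ≤ 1 ∧ 2 * (ij.1 : ℤ) + 3 * (ij.2 : ℤ) ≤ ℓ * (∑ z, t z) - c} K
        (AlgFunField.riemannRochSpace (EllipticPlaces.orbitDivisor W σ Q t c)),
      ∀ ij, (b ij : W.FunctionField) =
        EllipticPlaces.orbitFunction W σ Q t ij.1.1 ij.1.2 := by
  subst hℓ
  have hQ (z : Fin s) : ∃ (x y : K) (h : W.Nonsingular x y),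
      Q z = WeierstrassCurve.Affine.Point.some x y h := by
    -- The point at infinity is excluded by `2 • Q z ≠ 0`.
    rcases hz : Q z with _ | ⟨x, y, h⟩
    · exact absurd (by rw [hz]; exact smul_zero 2) (hQ2 z)
    · exact ⟨x, y, h, rfl⟩
  choose x y h hxy using hQ
  obtain rfl : Q = fun z => .some (x z) (y z) (h z) := funext hxy
  have hplace (z : Fin s) : EllipticPlaces.placeOf W (.some (x z) (y z) (h z)) =
      EllipticPlaces.affinePlace (h z) := rfl
  constructor
  -- All places involved are rational, hence of degree one, and each orbit has `ℓ` distinct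
  -- elements.
  · rw [EllipticPlaces.orbitDivisor, ← AlgFunField.Divisor.degreeHom_apply, map_sub, map_sum,
      map_zsmul, AlgFunField.Divisor.degreeHom_apply, AlgFunField.Divisor.degree_single,
      (EllipticPlaces.isRational_inftyPlace W).degree_eq_one]
    simp only [map_zsmul, map_sum, hplace, AlgFunField.Divisor.degreeHom_apply,
      EllipticPlaces.sum_orbit hσ hℓ' (hQ2 _) (hQ3 _), AlgFunField.Divisor.degree_single,
      ((EllipticPlaces.isRational_affinePlace (h _)).smul _).degree_eq_one]
    simp [Finset.sum_mul, mul_comm]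
  · set H := ∏ z, (∏ ρ ∈ Finset.range (orderOf σ / 2),
      (EllipticPlaces.funX W - algebraMap K W.FunctionField
        ((σ ^ ρ • EllipticPlaces.placeOf W (.some (x z) (y z) (h z))).eval
          (EllipticPlaces.funX W)))) ^ t z with hH
    have hprod (z : Fin s) : ∏ ρ ∈ Finset.range (orderOf σ / 2),
      (EllipticPlaces.funX W - algebraMap K W.FunctionField
        ((σ ^ ρ • EllipticPlaces.placeOf W (.some (x z) (y z) (h z))).eval
          (EllipticPlaces.funX W))) ≠ 0 :=
      Finset.prod_ne_zero_iff.mpr fun _ _ => EllipticPlaces.funX_sub_ne_zero _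
    have hH0 : H ≠ 0 := Finset.prod_ne_zero_iff.mpr fun z _ => zpow_ne_zero _ (hprod z)
    -- `div H = ∑ t_z (Orb(Q_z) - ℓ P_∞)`, which is `G + c P_∞ - ℓ (∑ t_z) P_∞`.
    have hG (P : AlgFunField.Place K W.FunctionField) : P.ord H =
        (EllipticPlaces.orbitDivisor W σ (fun z => .some (x z) (y z) (h z)) t c -
          ((orderOf σ : ℤ) * (∑ z, t z) - c) • Finsupp.single (EllipticPlaces.inftyPlace W) 1 :
            AlgFunField.Divisor K W.FunctionField) P := by
      rw [hH, P.ord_prod _ _ fun z _ => zpow_ne_zero _ (hprod z)]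
      simp only [P.ord_zpow, hplace,
        EllipticPlaces.ord_prod_funX_sub hσ hℓ' (hQ2 _) (hQ3 _) P, EllipticPlaces.orbitDivisor]
      simp only [Finsupp.sub_apply, Finsupp.finsetSum_apply, Finsupp.smul_apply, smul_eq_mul,
        mul_sub, Finset.sum_sub_distrib, nsmul_eq_mul, ← Finset.sum_mul]
      ring
    have hli := EllipticPlaces.linearIndependent_monomials (W := W)
      ((orderOf σ : ℤ) * (∑ z, t z) - c) hH0
    refine ⟨(Module.Basis.span hli).map
      (LinearEquiv.ofEq _ _ (EllipticPlaces.span_monomials_eq hH0 hG)), fun ij => ?_⟩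
    rw [Module.Basis.map_apply, LinearEquiv.coe_ofEq_apply, Module.Basis.span_apply]
    rfl
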